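/- All topological spaces and all (real, not necessarily locally convex) topological vector spaces are assumed Hausdorff. For a subset $Y$ of a real vector space let $\mathrm{conv}_2(Y)=\{ty+(1-t)y' : y,y'\in Y,\ t\in[0,1]\}$. **Setting.** Let $M$ be a topological space and $(M_\alpha)_{\alpha\in A}$ a directed family of topological spaces in $M$: $A$ is a directed set, the $M_\alpha$ are subsets of $M$ with topologies of their own, $M_\alpha\subseteq M_\beta$ for $\alpha\le\beta$, and all inclusion maps $M_\alpha\to M$ and $M_\alpha\to M_\beta$ ($\alpha\le\beta$) are continuous. Assume that $M_\infty:=\bigcup_{\alpha\in A}M_\alpha$ is dense in $M$. **Well-filled charts.** A homeomorphism $\phi\colon U\to V\subseteq E$ from an open set $U\subseteq M$ onto an arbitrary subset $V$ of a topological vector space $E$ is a *well-filled chart* of $M$ if there are $\alpha_0\in A$ and, for $\alpha\ge\alpha_0$, homeomorphisms $\phi_\alpha\colon U_\alpha\to V_\alpha\subseteq E_\alpha$ from open sets $U_\alpha\subseteq M_\alpha$ onto subsets $V_\alpha$ of topological vector spaces $E_\alpha$, and continuous linear maps $\lambda_\alpha\colon E_\alpha\to E$ and $\lambda_{\beta,\alpha}\colon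 E_\alpha\to E_\beta$ (for $\beta\ge\alpha\ge\alpha_0$), such that - (a) $U_\alpha\subseteq U$ and $\phi|_{U_\alpha}=\lambda_\alpha\circ\phi_\alpha$ for all $\alpha\ge\alpha_0$; - (b) $U_\alpha\subseteq U_\beta$ and $\phi_\beta|_{U_\alpha}=\lambda_{\beta,\alpha}\circ\phi_\alpha$ for all $\beta\ge\alpha\ge\alpha_0$; - (d) $\bigcup_{\alpha\ge\alpha_0}U_\alpha=U\cap M_\infty$; - (e) there is a non-empty, relatively open subset $V^{(2)}\subseteq V$ with $\mathrm{conv}_2(V^{(2)})\subseteq V$ and $\mathrm{conv}_2(V^{(2)}\cap V_\infty)\subseteq V_\infty$, where $V_\infty:=\bigcup_{\alpha\ge\alpha_0}\lambda_\alpha(V_\alpha)$; - (f) for each $\alpha\ge\alpha_0$ and each compact set $K\subseteq V_\alpha$ with $\lambda_\alpha(K)\subseteq V^{(2)}$ there is $\beta\ge\alpha$ with $\lambda_{\beta,\alpha}(\mathrm{conv}_2(K))\subseteq V_\beta$. Then $\phi^{-1}(V^{(2)})$ is called a *core* of $\phi$. The space $M$ *admits well-filled charts* if it is covered by cores of well-filled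 charts. **Homotopy classes.** For a topological space $X$, a subset $C\subseteq X$ and a point $p$ of a topological space $Y$, let $[(X,C),(Y,p)]$ be the set of classes of continuous maps $\gamma\colon X\to Y$ with $\gamma|_C=p$, modulo homotopy relative $C$. A continuous map $f\colon Y\to Z$ induces a map $[(X,C),(Y,p)]\to[(X,C),(Z,f(p))]$, $[\gamma]\mapsto[f\circ\gamma]$. **Theorem.** Let $\Sigma$ be a finite simplicial complex of simplices in a finite-dimensional real vector space, $X:=|\Sigma|$, and let $C\subseteq X$ be a union of simplices of $\Sigma$. Suppose that, in the above setting, $M$ admits well-filled charts. Let $p\in M_\infty$ and $A_p:=\{\alpha\in A: p\in M_\alpha\}$. Then, with the maps induced by the inclusions $M_\alpha\to M_\beta$ and $M_\alpha\to M$, $$[(X,C),(M,p)]\;=\;\varinjlim_{\alpha\in A_p}\,[(X,C),(M_\alpha,p)]$$ as a set; that is, $[(X,C),(M,p)]$ together with the maps $[(X,C),(M_\alpha,p)]\to[(X,C),(M,p)]$ is a direct limit, in the category of sets, of the direct system $([(X,C),(M_\alpha,p)])_{\alpha\in A_p}$. -/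

import Mathlib

universe u₁ u₂ u₃ u₄ u₅ z

/-- A directed family `(M_α)_{α ∈ A}` of topological spaces inside the topological space `M`:
each `M_α` is a subset of `M` with a topology of its own (in general not the subspace topology),
`M_α ⊆ M_β` for `α ≤ β`, and all inclusion maps `M_α → M` and `M_α → M_β` are continuous. -/
structure DirectedFamily (A : Type*) [Preorder A] (M : Type*) [TopologicalSpace M] where
  /-- the underlying set of `M_α` -/
  carrier : A → Set M
  mono : ∀ {α β : A}, α ≤ β → carrier α ⊆ carrier β
  /-- the topology of `M_α` -/
  top : ∀ α : A, TopologicalSpace (carrier α)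
  continuous_incl : ∀ α : A, @Continuous (carrier α) M (top α) _ Subtype.val
  continuous_trans : ∀ {α β : A} (h : α ≤ β),
    @Continuous (carrier α) (carrier β) (top α) (top β) (Set.inclusion (mono h))

namespace DirectedFamily

variable {A : Type*} [Preorder A] {M : Type*} [TopologicalSpace M] (D : DirectedFamily A M)

/-- The space `M_α`, with its own topology (a type synonym of the subtype, so that the subspace
topology does not interfere). -/
def Step (α : A) : Type _ := {x : M // x ∈ D.carrier α}

instance (α : A) : TopologicalSpace (D.Step α) := D.top α

/-- The union `M_∞` of all `M_α`. -/
def union : Set M := ⋃ α, D.carrier α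

/-- The inclusion map `M_α → M`. -/
def incl (α : A) : C(D.Step α, M) where
  toFun x := x.1
  continuous_toFun := D.continuous_incl α

/-- The inclusion map `M_α → M_β` for `α ≤ β`. -/
def trans {α β : A} (h : α ≤ β) : C(D.Step α, D.Step β) where
  toFun x := ⟨x.1, D.mono h x.2⟩
  continuous_toFun := D.continuous_trans h

/-- A point `p ∈ M_α`, as an element of the space `M_α`. -/
def pt {α : A} {p : M} (h : p ∈ D.carrier α) : D.Step α := ⟨p, h⟩

/-- A well-filled chart `φ : U → V ⊆ E` of `M`, together with the auxiliary data
`α₀`, `φ_α : U_α → V_α ⊆ E_α`, `λ_α`, `λ_{β,α}` (for `β ≥ α ≥ α₀`) and a set `V^{(2)}`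
witnessing that it is one. Here `conv₂(Y)` is `convexJoin ℝ Y Y`, the union of all segments
with end points in `Y`. -/
structure WellFilledChart {A : Type u₁} [Preorder A] {M : Type u₂} [TopologicalSpace M]
    (D : DirectedFamily A M) where
  /-- the topological vector space `E` -/
  E : Type u₃
  [addCommGroup : AddCommGroup E]
  [module : Module ℝ E]
  [topologicalSpace : TopologicalSpace E]
  [isTopologicalAddGroup : IsTopologicalAddGroup E]
  [continuousSMul : ContinuousSMul ℝ E]
  [t2Space : T2Space E]
  U : Set M
  isOpen_U : IsOpen U
  V : Set E
  φ : U ≃ₜ V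
  α₀ : A
  /-- the topological vector spaces `E_α`, for `α ≥ α₀` -/
  Es : Set.Ici α₀ → Type u₄
  [addCommGroups : ∀ α, AddCommGroup (Es α)]
  [modules : ∀ α, Module ℝ (Es α)]
  [topologicalSpaces : ∀ α, TopologicalSpace (Es α)]
  [isTopologicalAddGroups : ∀ α, IsTopologicalAddGroup (Es α)]
  [continuousSMuls : ∀ α, ContinuousSMul ℝ (Es α)]
  [t2Spaces : ∀ α, T2Space (Es α)]
  Us : ∀ α : Set.Ici α₀, Set (D.Step α)
  isOpen_Us : ∀ α, IsOpen (Us α)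
  Vs : ∀ α, Set (Es α)
  φs : ∀ α, Us α ≃ₜ Vs α
  /-- the continuous linear maps `λ_α : E_α → E` -/
  lam : ∀ α, Es α →L[ℝ] E
  /-- the continuous linear maps `λ_{β,α} : E_α → E_β` for `β ≥ α` -/
  lamTrans : ∀ {α β}, α ≤ β → (Es α →L[ℝ] Es β)
  /-- (a), first part: `U_α ⊆ U` -/
  Us_subset : ∀ (α : Set.Ici α₀) (x : D.Step α), x ∈ Us α → D.incl α x ∈ U
  /-- (a), second part: `φ|_{U_α} = λ_α ∘ φ_α` -/
  φ_eq : ∀ (α : Set.Ici α₀) (x : D.Step α) (hx : x ∈ Us α),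
    (φ ⟨D.incl α x, Us_subset α x hx⟩ : E) = lam α (φs α ⟨x, hx⟩)
  /-- (b), first part: `U_α ⊆ U_β` -/
  Us_mono : ∀ {α β : Set.Ici α₀} (h : α ≤ β) (x : D.Step α),
    x ∈ Us α → D.trans (show (α : A) ≤ β from h) x ∈ Us β
  /-- (b), second part: `φ_β|_{U_α} = λ_{β,α} ∘ φ_α` -/
  φs_eq : ∀ {α β : Set.Ici α₀} (h : α ≤ β) (x : D.Step α) (hx : x ∈ Us α),
    (φs β ⟨D.trans (show (α : A) ≤ β from h) x, Us_mono h x hx⟩ : Es β) =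
      lamTrans h (φs α ⟨x, hx⟩)
  /-- (d): `⋃_{α ≥ α₀} U_α = U ∩ M_∞` -/
  iUnion_Us : ⋃ α : Set.Ici α₀, D.incl α '' Us α = U ∩ D.union
  /-- the set `V^{(2)}` -/
  V2 : Set E
  V2_nonempty : V2.Nonempty
  V2_subset : V2 ⊆ V
  /-- `V^{(2)}` is relatively open in `V` -/
  isOpen_V2 : IsOpen ((↑) ⁻¹' V2 : Set V)
  /-- (e), first part: `conv₂(V^{(2)}) ⊆ V` -/
  conv_V2_subset : convexJoin ℝ V2 V2 ⊆ V
  /-- (e), second part: `conv₂(V^{(2)} ∩ V_∞) ⊆ V_∞`, where `V_∞ = ⋃_{α ≥ α₀} λ_α(V_α)` -/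
  conv_V2_inter_subset :
    convexJoin ℝ (V2 ∩ ⋃ α, lam α '' Vs α) (V2 ∩ ⋃ α, lam α '' Vs α) ⊆ ⋃ α, lam α '' Vs α
  /-- (f): if `K ⊆ E_α` is compact and contained in `V^{(2)} ∩ V_α`, then
  `conv₂(K) ⊆ V_β` for some `β ≥ α` -/
  exists_conv_subset : ∀ (α) (K : Set (Es α)), IsCompact K → K ⊆ Vs α → lam α '' K ⊆ V2 →
    ∃ (β : Set.Ici α₀) (h : α ≤ β), lamTrans h '' convexJoin ℝ K K ⊆ Vs β

/-- The core `U^{(2)} = φ⁻¹(V^{(2)})` of a well-filled chart. -/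
def WellFilledChart.core {D : DirectedFamily A M} (c : WellFilledChart D) : Set M :=
  {x | ∃ hx : x ∈ c.U, (c.φ ⟨x, hx⟩ : c.E) ∈ c.V2}

/-- `M` admits well-filled charts if it is covered by cores of well-filled charts. -/
def AdmitsWellFilledCharts {A : Type u₁} [Preorder A] {M : Type u₂} [TopologicalSpace M]
    (D : DirectedFamily A M) : Prop :=
  ∀ q : M, ∃ c : WellFilledChart.{u₁, u₂, u₃, u₄} D, q ∈ c.core

end DirectedFamily

section RelHomotopy

variable {X : Type*} [TopologicalSpace X] {Y : Type*} [TopologicalSpace Y]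
  {Z : Type*} [TopologicalSpace Z]

/-- Homotopy relative `C`, on the continuous maps `γ : X → Y` with `γ|_C = p`. -/
def relHomotopySetoid (C : Set X) (p : Y) : Setoid {γ : C(X, Y) // ∀ x ∈ C, γ x = p} where
  r γ η := ContinuousMap.HomotopicRel γ.1 η.1 C
  iseqv := ⟨fun γ => .refl γ.1, fun h => h.symm, fun h h' => h.trans h'⟩

/-- The set `[(X,C),(Y,p)]` of relative homotopy classes. -/
def RelHomotopyClasses (C : Set X) (p : Y) : Type _ := Quotient (relHomotopySetoid C p)

/-- The map `f_* : [(X,C),(Y,p)] → [(X,C),(Z,q)]`, `[γ] ↦ [f ∘ γ]`, for a continuous map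
`f : Y → Z` with `f p = q`. -/
def RelHomotopyClasses.map (C : Set X) {p : Y} {q : Z} (f : C(Y, Z)) (hf : f p = q) :
    RelHomotopyClasses C p → RelHomotopyClasses C q :=
  Quotient.map' (s₁ := relHomotopySetoid C p) (s₂ := relHomotopySetoid C q)
    (fun γ => ⟨f.comp γ.1, fun x hx => (congrArg f (γ.2 x hx)).trans hf⟩)
    (fun _ _ h => ContinuousMap.HomotopicRel.comp_continuousMap h f)

end RelHomotopy

/-- The maps `μ_i : G_i → L` form a direct limit cone, in the category of sets, over the direct
system of sets `G_i` and maps `f_{j,i} : G_i → G_j` (for `i ≤ j`). -/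
structure IsSetDirectLimit {ι : Type u₁} [Preorder ι] [IsDirectedOrder ι] {G : ι → Type u₂}
    (f : ∀ ⦃i j : ι⦄, i ≤ j → G i → G j) [DirectedSystem G f]
    {L : Type u₃} (μ : ∀ i, G i → L) : Prop where
  /-- the `μ_i` form a cone -/
  cone : ∀ ⦃i j : ι⦄ (h : i ≤ j), μ j ∘ f h = μ i
  /-- every cone factors through the `μ_i` by a unique map -/
  universal : ∀ (T : Type z) (g : ∀ i, G i → T), (∀ ⦃i j : ι⦄ (h : i ≤ j), g j ∘ f h = g i) →
    ∃! ψ : L → T, ∀ i, ψ ∘ μ i = g i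

namespace DirectedFamily

variable {A : Type*} [Preorder A] {M : Type*} [TopologicalSpace M] (D : DirectedFamily A M)

/-- The index set `A_p = {α ∈ A : p ∈ M_α}`. -/
abbrev Idx (p : M) : Type _ := {α : A // p ∈ D.carrier α}

instance (p : M) [IsDirectedOrder A] : IsDirectedOrder (D.Idx p) where
  directed a b := by
    obtain ⟨c, hac, hbc⟩ := exists_ge_ge a.1 b.1
    exact ⟨⟨c, D.mono hac a.2⟩, hac, hbc⟩

variable {X : Type*} [TopologicalSpace X] (C : Set X) (p : M)

/-- The set `[(X,C),(M_α,p)]`, for `α ∈ A_p`. -/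
abbrev StepClasses (α : D.Idx p) : Type _ := RelHomotopyClasses C (D.pt α.2)

/-- The map `[(X,C),(M_α,p)] → [(X,C),(M_β,p)]` induced by the inclusion `M_α → M_β`. -/
def transClasses ⦃α β : D.Idx p⦄ (h : α ≤ β) : D.StepClasses C p α → D.StepClasses C p β :=
  RelHomotopyClasses.map C (D.trans (show (α : A) ≤ β from h)) rfl

/-- The map `[(X,C),(M_α,p)] → [(X,C),(M,p)]` induced by the inclusion `M_α → M`. -/
def inclClasses (α : D.Idx p) : D.StepClasses C p α → RelHomotopyClasses C p :=
  RelHomotopyClasses.map C (D.incl α) rfl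

instance : DirectedSystem (D.StepClasses C p) (D.transClasses C p) where
  map_self α x := by
    induction x using Quotient.inductionOn'
    rfl
  map_map γ β α hαβ hβγ x := by
    induction x using Quotient.inductionOn'
    rfl

end DirectedFamily

/-! A direct limit of sets is detected by two properties: every class in `M` comes from some `M_α`,
and two classes of `M_α` that agree in `M` already agree in some `M_β`. Both follow from one
compression statement, `exists_compression`: a map on a compact polyhedron `Y` that lifts to some
`M_α` on a subcomplex `Y₀` is homotopic, relative to `Y₀`, to a map lifting to some `M_β`. For
surjectivity it is applied to `X` relative to `C`; for injectivity, to a homotopy on `X × [0,1]`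
relative to `X × {0,1} ∪ C × [0,1]`.

Compression is an induction over skeleta. A cell is a cone over its boundary. If the boundary has
been moved into some `M_α`, inside a small set in a chart, then condition (f) lets the moved
boundary be coned off linearly inside some `M_β`, and a straight-line homotopy in the chart joins
the old map to this cone (`exists_isFillable`). Vertices are moved into `M_∞` along segments, by
density. For this, each cell must be mapped into one chart and the homotopy on its boundary must
stay small. The cells are therefore subdivided at each inductive step, and the induction carries an
open set `𝒲` of `F × M` that contains the graph of the homotopy at all times. Since there are
finitely many cells, one index `β` serves them all.

Charts need not be locally convex. Two-point convexity suffices, because a neighbourhood contains a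
smaller one whose segments stay in it. Polyhedra are treated as unions of cells of finite hyperplane
arrangements: refinement just adds hyperplanes, and cylinders are again of this kind. -/

namespace DirectedFamily

open scoped unitInterval Topology
open Set

-- Segments and compact families in a well-filled chart

attribute [instance] WellFilledChart.addCommGroup WellFilledChart.module
  WellFilledChart.topologicalSpace WellFilledChart.isTopologicalAddGroup
  WellFilledChart.continuousSMul WellFilledChart.t2Space WellFilledChart.addCommGroups
  WellFilledChart.modules WellFilledChart.topologicalSpaces
  WellFilledChart.isTopologicalAddGroups WellFilledChart.continuousSMuls
  WellFilledChart.t2Spaces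

/-- In a topological vector space, segments between points close to `v` stay close to `v`. -/
theorem exists_nhds_segment {E : Type*} [AddCommGroup E] [Module ℝ E] [TopologicalSpace E]
    [IsTopologicalAddGroup E] [ContinuousSMul ℝ E] {v : E} {O : Set E} (hO : O ∈ 𝓝 v) :
    ∃ O', IsOpen O' ∧ v ∈ O' ∧ ∀ x ∈ O', ∀ y ∈ O', ∀ t : I,
      (1 - (t : ℝ)) • x + (t : ℝ) • y ∈ O := by
  have key : ∀ᶠ q : E × E in 𝓝 (v, v), ∀ t ∈ (univ : Set I),
      (1 - (t : ℝ)) • q.1 + (t : ℝ) • q.2 ∈ O := by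
    -- A tube-lemma argument: each combination of `v` with itself is `v`, and the parameter interval
    -- is compact.
    refine isCompact_univ.eventually_forall_of_forall_eventually fun t _ => ?_
    have hc : Continuous fun r : (E × E) × I =>
        (1 - (r.2 : ℝ)) • r.1.1 + (r.2 : ℝ) • r.1.2 := by fun_prop
    refine hc.continuousAt.eventually_mem ?_
    simpa [← add_smul] using hO
  rw [nhds_prod_eq] at key
  obtain ⟨s, hs, t, ht, hst⟩ := Filter.mem_prod_iff.1 key
  obtain ⟨O', hO', ho, hv⟩ := mem_nhds_iff.1 (Filter.inter_mem hs ht)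
  exact ⟨O', ho, hv, fun x hx y hy r => hst (mk_mem_prod (hO' hx).1 (hO' hy).2) r (mem_univ _)⟩

variable {A : Type u₁} [Preorder A] {M : Type u₂} [TopologicalSpace M] {D : DirectedFamily A M}

namespace WellFilledChart

variable (c : WellFilledChart.{u₁, u₂, u₃, u₄} D)

/-- The image `φ(W ∩ U)` of a set `W`. -/
def image (W : Set M) : Set c.E := {v | ∃ hv : v ∈ c.V, (c.φ.symm ⟨v, hv⟩ : M) ∈ W}

theorem mem_image_iff {W : Set M} {x : M} (hx : x ∈ c.U) :
    (c.φ ⟨x, hx⟩ : c.E) ∈ c.image W ↔ x ∈ W := by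
  simp [image]

theorem core_subset : c.core ⊆ c.U := fun _ h => h.1

theorem isOpen_preimage_image {W : Set M} (hW : IsOpen W) :
    ∃ O : Set c.E, IsOpen O ∧ c.image W = c.V ∩ O := by
  obtain ⟨O, hO, h⟩ := isOpen_induced_iff.1
    (hW.preimage (continuous_subtype_val.comp c.φ.symm.continuous))
  refine ⟨O, hO, ?_⟩
  ext v
  constructor
  · rintro ⟨hv, hw⟩
    exact ⟨hv, (Set.ext_iff.1 h ⟨v, hv⟩).2 hw⟩
  · rintro ⟨hv, hw⟩
    exact ⟨hv, (Set.ext_iff.1 h ⟨v, hv⟩).1 hw⟩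

/-- Each neighbourhood `W` of a point of the core contains a neighbourhood `W'` such that, in the
chart, segments with end points in `W'` are contained in `W`. -/
theorem exists_isOpen_segment {q : M} (hq : q ∈ c.core) {W : Set M} (hW : IsOpen W)
    (hqW : q ∈ W) :
    ∃ W', IsOpen W' ∧ q ∈ W' ∧ W' ⊆ W ∧ W' ⊆ c.core ∧ c.image W' ⊆ c.V2 ∧
      ∀ v ∈ c.image W', ∀ w ∈ c.image W', ∀ t : I,
        (1 - (t : ℝ)) • v + (t : ℝ) • w ∈ c.image W := by
  obtain ⟨hqU, hq2⟩ := hq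
  obtain ⟨O, hO, hWO⟩ := c.isOpen_preimage_image hW
  have hqO : (c.φ ⟨q, hqU⟩ : c.E) ∈ O := by
    have := (c.mem_image_iff hqU).2 hqW
    rw [hWO] at this
    exact this.2
  obtain ⟨O', ho', hq', hseg⟩ := exists_nhds_segment (hO.mem_nhds hqO)
  -- The neighbourhood is cut out in the chart by two conditions: `V2` keeps segments inside `V` by
  -- (e), and `O'` keeps them inside `O`.
  have himg : c.image (Subtype.val '' (c.φ ⁻¹' (Subtype.val ⁻¹' (c.V2 ∩ O')))) ⊆ c.V2 ∩ O' := by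
    rintro v ⟨hv, x, hx, hxv⟩
    rw [Subtype.coe_injective hxv] at hx
    simpa using hx
  refine ⟨Subtype.val '' (c.φ ⁻¹' (Subtype.val ⁻¹' (c.V2 ∩ O'))), ?_, ⟨_, ⟨hq2, hq'⟩, rfl⟩,
    ?_, ?_, fun v hv => (himg hv).1, ?_⟩
  · refine c.isOpen_U.isOpenMap_subtype_val _ (IsOpen.preimage c.φ.continuous ?_)
    rw [preimage_inter]
    exact c.isOpen_V2.inter (ho'.preimage continuous_subtype_val)
  · rintro _ ⟨x, hx, rfl⟩
    rw [← c.mem_image_iff x.2, hWO]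
    refine ⟨(c.φ x).2, ?_⟩
    simpa [← add_smul] using hseg _ hx.2 _ hx.2 0
  · rintro _ ⟨x, hx, rfl⟩
    exact ⟨x.2, hx.1⟩
  · intro v hv w hw t
    rw [hWO]
    refine ⟨c.conv_V2_subset ?_, hseg _ (himg hv).2 _ (himg hw).2 t⟩
    rw [mem_convexJoin]
    exact ⟨v, (himg hv).1, w, (himg hw).1, 1 - t, t, sub_nonneg.2 t.2.2, t.2.1, by ring, rfl⟩

/-- The chart expression of a continuous map into `U`. -/
theorem continuous_chart {Z : Type*} [TopologicalSpace Z] {f : Z → M} (hf : Continuous f)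
    (hU : ∀ x, f x ∈ c.U) : Continuous fun x => (c.φ ⟨f x, hU x⟩ : c.E) :=
  continuous_subtype_val.comp (c.φ.continuous.comp (hf.subtype_mk _))

theorem continuous_symm {Z : Type*} [TopologicalSpace Z] {f : Z → c.E} (hf : Continuous f)
    (hV : ∀ x, f x ∈ c.V) : Continuous fun x => (c.φ.symm ⟨f x, hV x⟩ : M) :=
  continuous_subtype_val.comp (c.φ.symm.continuous.comp (hf.subtype_mk _))

/-- A compact family of points of `U ∩ M_α` is contained in some `U_β`. -/
theorem exists_forall_mem_Us [IsDirectedOrder A] {B : Type*} [TopologicalSpace B]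
    [CompactSpace B] {α : A} (g : C(B, D.Step α)) (hg : ∀ b, D.incl α (g b) ∈ c.U) :
    ∃ (β : Set.Ici c.α₀) (h : α ≤ β), ∀ b, D.trans h (g b) ∈ c.Us β := by
  obtain ⟨α₁, hα, hα₀⟩ := exists_ge_ge α c.α₀
  let J := {β : Set.Ici c.α₀ // α ≤ β}
  let S : J → Set B := fun β => {b | D.trans β.2 (g b) ∈ c.Us β.1}
  -- The preimages of the `U_β` form a directed open cover of `B`, so by compactness one of them is
  -- everything.
  have hdir : Directed (· ⊆ ·) S := by
    intro β γ
    obtain ⟨δ, h₁, h₂⟩ := exists_ge_ge (β.1 : A) γ.1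
    exact ⟨⟨⟨δ, le_trans β.1.2 h₁⟩, le_trans β.2 h₁⟩,
      fun b hb => c.Us_mono (β := ⟨δ, le_trans β.1.2 h₁⟩) h₁ _ hb,
      fun b hb => c.Us_mono (β := ⟨δ, le_trans β.1.2 h₁⟩) h₂ _ hb⟩
  have hne : Nonempty J := ⟨⟨⟨α₁, hα₀⟩, hα⟩⟩
  have hcov : (univ : Set B) ⊆ ⋃ β, S β := by
    intro b _
    have : D.incl α (g b) ∈ ⋃ α : Set.Ici c.α₀, D.incl α '' c.Us α := by
      rw [c.iUnion_Us]
      exact ⟨hg b, mem_iUnion.2 ⟨α, (g b).2⟩⟩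
    obtain ⟨γ, x, hx, hxg⟩ := mem_iUnion.1 this
    obtain ⟨δ, h₁, h₂⟩ := exists_ge_ge (γ : A) α
    refine mem_iUnion.2 ⟨⟨⟨δ, le_trans γ.2 h₁⟩, h₂⟩, ?_⟩
    have hm := c.Us_mono (β := ⟨δ, le_trans γ.2 h₁⟩) h₁ x hx
    have : D.trans h₁ x = D.trans h₂ (g b) := Subtype.ext hxg
    change D.trans h₂ (g b) ∈ c.Us ⟨δ, le_trans γ.2 h₁⟩
    rwa [← this]
  obtain ⟨β, hβ⟩ := isCompact_univ.elim_directed_cover S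
    (fun β => (c.isOpen_Us β.1).preimage ((D.trans β.2).continuous.comp g.continuous)) hcov hdir
  exact ⟨β.1, β.2, fun b => hβ (mem_univ b)⟩

end WellFilledChart

end DirectedFamily

/-! ### Coning off a family and extending homotopies over a cone -/

namespace DirectedFamily

open scoped unitInterval Topology
open Set

/-- Given a map `γ` on a cone `B × [0,1]` and a homotopy `h` on its base `B × {1}`, the
radial extension of `h` to a homotopy of `γ`. -/
noncomputable def radialExtension {B M : Type*} (γ h : B × I → M) (z : (B × I) × I) : M :=
  if (1 + z.2 : ℝ) * z.1.2 ≤ 1 then γ (z.1.1, projIcc 0 1 zero_le_one ((1 + z.2 : ℝ) * z.1.2))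
  else h (z.1.1, projIcc 0 1 zero_le_one ((1 + z.2 : ℝ) * z.1.2 - 1))

section radialExtension

variable {B M : Type*} {γ h : B × I → M}

theorem continuous_radialExtension [TopologicalSpace B] [TopologicalSpace M]
    (hγ : Continuous γ) (hh : Continuous h)
    (h0 : ∀ b, h (b, 0) = γ (b, 1)) : Continuous (radialExtension γ h) := by
  unfold radialExtension
  refine Continuous.if_le ?_ ?_ (by fun_prop) continuous_const ?_
  · exact hγ.comp (by fun_prop)
  · exact hh.comp (by fun_prop)
  · intro z hz
    have h1 : projIcc (0 : ℝ) 1 zero_le_one 1 = 1 := projIcc_right _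
    have h2 : projIcc (0 : ℝ) 1 zero_le_one 0 = 0 := projIcc_left _
    rw [hz, sub_self, h1, h2, h0]

theorem radialExtension_mem {W : Set M} (hγ : ∀ z, γ z ∈ W) (hh : ∀ z, h z ∈ W)
    (z : (B × I) × I) : radialExtension γ h z ∈ W := by
  unfold radialExtension
  split_ifs
  exacts [hγ _, hh _]

theorem radialExtension_zero (b : B) (s : I) : radialExtension γ h ((b, s), 0) = γ (b, s) := by
  simp [radialExtension, s.2.2]

theorem radialExtension_one (h0 : ∀ b, h (b, 0) = γ (b, 1)) (b : B) (t : I) :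
    radialExtension γ h ((b, 1), t) = h (b, t) := by
  unfold radialExtension
  split_ifs with hc
  · have : t = 0 := Subtype.ext (le_antisymm (by simpa using hc) t.2.1)
    subst this
    simp [h0]
  · simp

theorem radialExtension_apex (b : B) (t : I) :
    radialExtension γ h ((b, 0), t) = γ (b, 0) := by
  simp [radialExtension]

end radialExtension

variable {A : Type u₁} [Preorder A] {M : Type u₂} [TopologicalSpace M] {D : DirectedFamily A M}

/-- Over a core, a compact family of points of some `M_α` can be coned off in some `M_β`. -/
theorem WellFilledChart.exists_cone [IsDirectedOrder A]
    (c : WellFilledChart.{u₁, u₂, u₃, u₄} D) {B : Type*} [TopologicalSpace B] [CompactSpace B]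
    {α : A} (g : C(B, D.Step α)) (hU : ∀ b, D.incl α (g b) ∈ c.U)
    (hg : ∀ b, (c.φ ⟨D.incl α (g b), hU b⟩ : c.E) ∈ c.V2) (b₀ : B) :
    ∃ (β : A) (_ : α ≤ β) (G : C(B × I, D.Step β)) (hG : ∀ z, D.incl β (G z) ∈ c.U),
      ∀ z : B × I, (c.φ ⟨D.incl β (G z), hG z⟩ : c.E) =
        (1 - (z.2 : ℝ)) • (c.φ ⟨D.incl α (g b₀), hU b₀⟩ : c.E) +
          (z.2 : ℝ) • (c.φ ⟨D.incl α (g z.1), hU z.1⟩ : c.E) := by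
  obtain ⟨δ, hαδ, hδ⟩ := c.exists_forall_mem_Us g hU
  let f : B → c.Es δ := fun b => c.φs δ ⟨D.trans hαδ (g b), hδ b⟩
  have hf : Continuous f := continuous_subtype_val.comp ((c.φs δ).continuous.comp
    (((D.trans hαδ).continuous.comp g.continuous).subtype_mk _))
  have hlam : ∀ b, c.lam δ (f b) = (c.φ ⟨D.incl α (g b), hU b⟩ : c.E) := fun b =>
    (c.φ_eq δ _ (hδ b)).symm
  -- The only use of (f): the segments from the apex `f b₀` to the compact set `f(B)` map into some
  -- `V_β`.
  obtain ⟨β, hδβ, hβ⟩ := c.exists_conv_subset δ (range f) (isCompact_range hf)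
    (by rintro _ ⟨b, rfl⟩; exact (c.φs δ _).2)
    (by rintro _ ⟨_, ⟨b, rfl⟩, rfl⟩; rw [hlam]; exact hg b)
  let f' : B × I → c.Es β := fun z => c.lamTrans hδβ ((1 - (z.2 : ℝ)) • f b₀ + (z.2 : ℝ) • f z.1)
  have hf' : Continuous f' := (c.lamTrans hδβ).continuous.comp (by fun_prop)
  have hfV : ∀ z, f' z ∈ c.Vs β := by
    intro z
    refine hβ (mem_image_of_mem _ ?_)
    rw [mem_convexJoin]
    exact ⟨f b₀, mem_range_self _, f z.1, mem_range_self _, 1 - z.2, z.2,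
      sub_nonneg.2 z.2.2.2, z.2.2.1, by ring, rfl⟩
  have hG : ∀ z, D.incl β ((c.φs β).symm ⟨f' z, hfV z⟩ : D.Step β) ∈ c.U := fun z =>
    c.Us_subset β _ ((c.φs β).symm ⟨f' z, hfV z⟩).2
  refine ⟨β, le_trans hαδ hδβ, ⟨fun z => ((c.φs β).symm ⟨f' z, hfV z⟩ : D.Step β),
    continuous_subtype_val.comp ((c.φs β).symm.continuous.comp (hf'.subtype_mk _))⟩, hG, ?_⟩
  intro z
  -- Compatibility of the linear maps is needed only at chart points `f b`, where (a) and (b) give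
  -- it; linearity then extends the formula to the cone.
  have key : ∀ b, c.lam β (c.lamTrans hδβ (f b)) = (c.φ ⟨D.incl α (g b), hU b⟩ : c.E) := by
    intro b
    have h1 := c.φs_eq hδβ (D.trans hαδ (g b)) (hδ b)
    have h2 := c.φ_eq β _ (c.Us_mono hδβ (D.trans hαδ (g b)) (hδ b))
    rw [h1] at h2
    exact h2.symm
  have h3 := c.φ_eq β _ ((c.φs β).symm ⟨f' z, hfV z⟩).2
  refine h3.trans ?_
  simp only [Subtype.coe_eta, Homeomorph.apply_symm_apply, f', map_add, map_smul, key]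

/-- `W' ⊆ W`, points of `W'` can be joined in `W` to points of some `M_β`, and homotopies in `W'`
on the base of a cone, with end in `M_α`, extend to homotopies of the cone in `W`, with end in
some `M_β`. -/
structure IsFillable (D : DirectedFamily A M) (W' W : Set M) : Prop where
  subset : W' ⊆ W
  exists_path : ∀ x ∈ W', ∀ α : A, ∃ (β : A) (_ : α ≤ β) (H : C(I, M)),
    H 0 = x ∧ H 1 ∈ D.carrier β ∧ ∀ t, H t ∈ W
  exists_extension : ∀ (B : Type u₅) [TopologicalSpace B] [CompactSpace B] [Nonempty B]
    (γ h : C(B × I, M)) (α : A) (g : C(B, D.Step α)),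
    (∀ z, γ z ∈ W') → (∀ z, h z ∈ W') → (∀ b b', γ (b, 0) = γ (b', 0)) →
    (∀ b, h (b, 0) = γ (b, 1)) → (∀ b, D.incl α (g b) = h (b, 1)) →
    ∃ (β : A) (_ : α ≤ β) (H : C((B × I) × I, M)) (G : C(B × I, D.Step β)),
      (∀ z, H z ∈ W) ∧ (∀ z, H (z, 0) = γ z) ∧ (∀ b t, H ((b, 1), t) = h (b, t)) ∧
      (∀ b b' t, H ((b, 0), t) = H ((b', 0), t)) ∧ ∀ z, D.incl β (G z) = H (z, 1)

/-- Extend `h` radially over the cone to `R`, and deform `R` at time `t`, along chart segments,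
towards the linear cone `Γ` over `h(·, t)` with a fixed apex. At time `0` this is `γ`. At time `1`
it is the linear cone over `h(·, 1)`, which lies in some `M_β`. On the base, `R` and `Γ` both equal
`h`, so nothing moves there beyond `h`. -/
theorem exists_isFillable [IsDirectedOrder A] (hdense : Dense D.union)
    (hM : AdmitsWellFilledCharts.{u₁, u₂, u₃, u₄} D) (q : M) {W : Set M} (hW : IsOpen W)
    (hqW : q ∈ W) : ∃ W', IsOpen W' ∧ q ∈ W' ∧ IsFillable.{u₁, u₂, u₅} D W' W := by
  obtain ⟨c, hc⟩ := hM q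
  -- Two nested shrinkings, since segments are taken twice: once to form `Γ`, once to join `R` to
  -- `Γ`.
  obtain ⟨W₁, hW₁, hq₁, hsub₁, hcore₁, -, hseg₁⟩ := c.exists_isOpen_segment hc hW hqW
  obtain ⟨W₂, hW₂, hq₂, hsub₂, hcore₂, hV2, hseg₂⟩ := c.exists_isOpen_segment hc hW₁ hq₁
  have hU₁ : W₁ ⊆ c.U := hcore₁.trans c.core_subset
  have hU₂ : W₂ ⊆ c.U := hsub₂.trans hU₁
  have himg : ∀ {W : Set M} {x : M} (hx : x ∈ c.U), x ∈ W → (c.φ ⟨x, hx⟩ : c.E) ∈ c.image W :=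
    fun hx h => (c.mem_image_iff hx).2 h
  refine ⟨W₂, hW₂, hq₂, hsub₂.trans hsub₁, ?_, ?_⟩
  · intro x hx α
    obtain ⟨m, hm₂, hm⟩ := hdense.inter_open_nonempty W₂ hW₂ ⟨q, hq₂⟩
    obtain ⟨α', hα'⟩ := mem_iUnion.1 hm
    obtain ⟨β, hαβ, hα'β⟩ := exists_ge_ge α α'
    have hv : ∀ t : I, (1 - (t : ℝ)) • (c.φ ⟨x, hU₂ hx⟩ : c.E) +
        (t : ℝ) • (c.φ ⟨m, hU₂ hm₂⟩ : c.E) ∈ c.image W := fun t =>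
      hseg₁ _ (himg _ (hsub₂ hx)) _ (himg _ (hsub₂ hm₂)) t
    refine ⟨β, hαβ, ⟨_, c.continuous_symm (by fun_prop) fun t => (hv t).1⟩, ?_, ?_,
      fun t => (hv t).2⟩
    · simp
    · simpa using D.mono hα'β hα'
  · intro B _ _ _ γ h α g hγ hh hγ0 h0 hg
    obtain ⟨b₀⟩ := ‹Nonempty B›
    have hgW : ∀ b, D.incl α (g b) ∈ W₂ := fun b => hg b ▸ hh _
    obtain ⟨β, hαβ, G, hG, hGφ⟩ := c.exists_cone g (fun b => hU₂ (hgW b))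
      (fun b => hV2 (himg _ (hgW b))) b₀
    let R := radialExtension γ h
    have hRc : Continuous R := continuous_radialExtension γ.continuous h.continuous h0
    have hRW : ∀ z, R z ∈ W₂ := radialExtension_mem hγ hh
    let v : B × I → c.E := fun z => c.φ ⟨h z, hU₂ (hh z)⟩
    have hv : Continuous v := c.continuous_chart h.continuous _
    let Γ : (B × I) × I → c.E := fun z =>
      (1 - (z.1.2 : ℝ)) • v (b₀, 1) + (z.1.2 : ℝ) • v (z.1.1, z.2)
    have hΓ : Continuous Γ := by fun_prop
    have hΓW : ∀ z, Γ z ∈ c.image W₁ := fun z =>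
      hseg₂ _ (himg _ (hh _)) _ (himg _ (hh _)) z.1.2
    let r : (B × I) × I → c.E := fun z => c.φ ⟨R z, hU₂ (hRW z)⟩
    have hr : Continuous r := c.continuous_chart hRc _
    let Φ : (B × I) × I → c.E := fun z => (1 - (z.2 : ℝ)) • r z + (z.2 : ℝ) • Γ z
    have hΦ : Continuous Φ := by fun_prop
    have hΦW : ∀ z, Φ z ∈ c.image W := fun z =>
      hseg₁ _ (himg _ (hsub₂ (hRW z))) _ (hΓW z) z.2
    have hsymm : ∀ {x : M} (hx : x ∈ c.U) z, Φ z = c.φ ⟨x, hx⟩ →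
        (c.φ.symm ⟨Φ z, (hΦW z).1⟩ : M) = x := by
      intro x hx z hz
      have : (⟨Φ z, (hΦW z).1⟩ : c.V) = c.φ ⟨x, hx⟩ := Subtype.ext hz
      rw [this, Homeomorph.symm_apply_apply]
    refine ⟨β, hαβ, ⟨_, c.continuous_symm hΦ fun z => (hΦW z).1⟩, G, fun z => (hΦW z).2,
      ?_, ?_, ?_, ?_⟩
    · rintro ⟨b, s⟩
      refine hsymm (hU₂ (hγ _)) _ ?_
      simp [Φ, r, R, radialExtension_zero]
    · intro b t
      refine hsymm (hU₂ (hh _)) _ ?_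
      simp [Φ, r, R, radialExtension_one h0, Γ, v, ← add_smul]
    · intro b b' t
      have : Φ ((b, 0), t) = Φ ((b', 0), t) := by
        simp [Φ, r, R, Γ, radialExtension_apex, hγ0 b b']
      simp [this]
    · intro z
      refine (hsymm (hG z) _ ?_).symm
      rw [hGφ]
      simp [Φ, Γ, v, hg]

end DirectedFamily

/-! ### Cells of hyperplane arrangements as cones over their boundaries -/

namespace Arrangement

open scoped unitInterval Topology
open Set

section Algebra

variable {F : Type*} [AddCommGroup F] [Module ℝ F] {𝓛 𝓛' : Set (F →ᵃ[ℝ] ℝ)} {x y w : F}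

/-- The closed cell of the point `x` in the hyperplane arrangement `{ℓ = 0}`, `ℓ ∈ 𝓛`: the
intersection of all half-spaces `ℓ ≥ 0` and `ℓ ≤ 0` which contain `x`. -/
def cell (𝓛 : Set (F →ᵃ[ℝ] ℝ)) (x : F) : Set F :=
  {y | ∀ ℓ ∈ 𝓛, (0 ≤ ℓ x → 0 ≤ ℓ y) ∧ (ℓ x ≤ 0 → ℓ y ≤ 0)}

/-- The relative boundary of the closed cell of `x`. -/
def boundary (𝓛 : Set (F →ᵃ[ℝ] ℝ)) (x : F) : Set F := {y | y ∈ cell 𝓛 x ∧ x ∉ cell 𝓛 y}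

/-- The direction of the affine span of the cell of `x`. -/
def direction (𝓛 : Set (F →ᵃ[ℝ] ℝ)) (x : F) : Submodule ℝ F where
  carrier := {v | ∀ ℓ ∈ 𝓛, ℓ x = 0 → ℓ.linear v = 0}
  add_mem' ha hb ℓ hℓ h := by rw [map_add, ha ℓ hℓ h, hb ℓ hℓ h, add_zero]
  zero_mem' ℓ _ _ := map_zero _
  smul_mem' c v hv ℓ hℓ h := by rw [map_smul, hv ℓ hℓ h, smul_zero]

/-- The dimension of the cell of `x`. -/
noncomputable def dim (𝓛 : Set (F →ᵃ[ℝ] ℝ)) (x : F) : ℕ := Module.finrank ℝ (direction 𝓛 x)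

/-- A set is saturated if it is a union of closed cells. -/
def Saturated (𝓛 : Set (F →ᵃ[ℝ] ℝ)) (Y : Set F) : Prop := ∀ x ∈ Y, cell 𝓛 x ⊆ Y

theorem mem_cell_self : x ∈ cell 𝓛 x := fun _ _ => ⟨id, id⟩

theorem cell_subset_cell (h : y ∈ cell 𝓛 x) : cell 𝓛 y ⊆ cell 𝓛 x := fun _ hz ℓ hℓ =>
  ⟨(hz ℓ hℓ).1 ∘ (h ℓ hℓ).1, (hz ℓ hℓ).2 ∘ (h ℓ hℓ).2⟩

theorem cell_anti (h : 𝓛 ⊆ 𝓛') : cell 𝓛' x ⊆ cell 𝓛 x := fun _ hy ℓ hℓ => hy ℓ (h hℓ)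

theorem Saturated.mono {Y : Set F} (hY : Saturated 𝓛 Y) (h : 𝓛 ⊆ 𝓛') : Saturated 𝓛' Y :=
  fun x hx => (cell_anti h).trans (hY x hx)

theorem Saturated.union {Y Z : Set F} (hY : Saturated 𝓛 Y) (hZ : Saturated 𝓛 Z) :
    Saturated 𝓛 (Y ∪ Z) := fun x hx =>
  hx.elim (fun h => (hY x h).trans subset_union_left) fun h => (hZ x h).trans subset_union_right

theorem eq_zero_of_mem_cell (h : y ∈ cell 𝓛 x) {ℓ : F →ᵃ[ℝ] ℝ} (hℓ : ℓ ∈ 𝓛) (hx : ℓ x = 0) :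
    ℓ y = 0 :=
  le_antisymm ((h ℓ hℓ).2 hx.le) ((h ℓ hℓ).1 hx.ge)

/-- Otherwise every `ℓ ∈ 𝓛` would have the same sign at `x` and at `y`, putting `x` in the cell of
`y`. -/
theorem exists_of_mem_boundary (h : y ∈ boundary 𝓛 x) : ∃ ℓ ∈ 𝓛, ℓ x ≠ 0 ∧ ℓ y = 0 := by
  by_contra! hne
  refine h.2 fun ℓ hℓ => ?_
  rcases lt_trichotomy (ℓ x) 0 with hx | hx | hx
  · have := (h.1 ℓ hℓ).2 hx.le
    have := hne ℓ hℓ hx.ne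
    exact ⟨fun h' => (this (le_antisymm ‹_› h')).elim, fun _ => hx.le⟩
  · exact ⟨fun _ => hx.ge, fun _ => hx.le⟩
  · have := (h.1 ℓ hℓ).1 hx.le
    have := hne ℓ hℓ hx.ne'
    exact ⟨fun _ => hx.le, fun h' => (this (le_antisymm h' ‹_›)).elim⟩

theorem mem_boundary_of_eq_zero (h : y ∈ cell 𝓛 x) {ℓ : F →ᵃ[ℝ] ℝ} (hℓ : ℓ ∈ 𝓛) (hx : ℓ x ≠ 0)
    (hy : ℓ y = 0) : y ∈ boundary 𝓛 x :=
  ⟨h, fun h' => hx (eq_zero_of_mem_cell h' hℓ hy)⟩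

theorem direction_le_of_mem_cell (h : y ∈ cell 𝓛 x) : direction 𝓛 y ≤ direction 𝓛 x :=
  fun _ hv ℓ hℓ hx => hv ℓ hℓ (eq_zero_of_mem_cell h hℓ hx)

theorem sub_mem_direction (h : y ∈ cell 𝓛 x) : y - x ∈ direction 𝓛 x := fun ℓ hℓ hx => by
  rw [← vsub_eq_sub, AffineMap.linearMap_vsub, eq_zero_of_mem_cell h hℓ hx, hx, vsub_self]

/-- The vector `y - x` separates the two directions: some `ℓ` vanishes at `y` but not at `x`, so its
linear part does not kill `y - x`. -/
theorem dim_lt_of_mem_boundary [FiniteDimensional ℝ F] (h : y ∈ boundary 𝓛 x) :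
    dim 𝓛 y < dim 𝓛 x := by
  obtain ⟨ℓ, hℓ, hx, hy⟩ := exists_of_mem_boundary h
  refine Submodule.finrank_lt_finrank_of_lt
    (lt_of_le_of_ne (direction_le_of_mem_cell h.1) fun heq => hx ?_)
  have h1 : y - x ∈ direction 𝓛 y := heq ▸ sub_mem_direction h.1
  have h2 := h1 ℓ hℓ hy
  rw [← vsub_eq_sub, AffineMap.linearMap_vsub, hy, vsub_eq_sub, zero_sub, neg_eq_zero] at h2
  exact h2

theorem dim_le_of_mem_cell [FiniteDimensional ℝ F] (h : y ∈ cell 𝓛 x) : dim 𝓛 y ≤ dim 𝓛 x :=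
  Submodule.finrank_mono (direction_le_of_mem_cell h)

theorem dim_anti [FiniteDimensional ℝ F] (h : 𝓛 ⊆ 𝓛') : dim 𝓛' x ≤ dim 𝓛 x :=
  Submodule.finrank_mono fun _ hv ℓ hℓ hx => hv ℓ (h hℓ) hx

/-- A cell depends only on which `ℓ ∈ 𝓛` are nonnegative and which are nonpositive at its center. -/
theorem finite_range_cell (h𝓛 : 𝓛.Finite) : (range (cell 𝓛)).Finite := by
  let f : Set (F →ᵃ[ℝ] ℝ) × Set (F →ᵃ[ℝ] ℝ) → Set F := fun P =>
    {y | (∀ ℓ ∈ P.1, 0 ≤ ℓ y) ∧ ∀ ℓ ∈ P.2, ℓ y ≤ 0}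
  refine ((h𝓛.finite_subsets.prod h𝓛.finite_subsets).image f).subset ?_
  rintro _ ⟨x, rfl⟩
  refine ⟨({ℓ ∈ 𝓛 | 0 ≤ ℓ x}, {ℓ ∈ 𝓛 | ℓ x ≤ 0}), ⟨sep_subset _ _, sep_subset _ _⟩, ?_⟩
  ext y
  constructor
  · exact fun h ℓ hℓ => ⟨fun h' => h.1 ℓ ⟨hℓ, h'⟩, fun h' => h.2 ℓ ⟨hℓ, h'⟩⟩
  · exact fun h => ⟨fun ℓ hℓ => (h ℓ hℓ.1).1 hℓ.2, fun ℓ hℓ => (h ℓ hℓ.1).2 hℓ.2⟩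

theorem lineMap_mem_cell (h : y ∈ cell 𝓛 x) (s : I) :
    AffineMap.lineMap x y (s : ℝ) ∈ cell 𝓛 x := fun ℓ hℓ => by
  have h0 := s.2.1
  have h1 := sub_nonneg.2 s.2.2
  rw [AffineMap.apply_lineMap, AffineMap.lineMap_apply_module, smul_eq_mul, smul_eq_mul]
  constructor
  · intro hx
    have := (h ℓ hℓ).1 hx
    positivity
  · intro hx
    have := (h ℓ hℓ).2 hx
    nlinarith [mul_nonneg h1 (neg_nonneg.2 hx), mul_nonneg h0 (neg_nonneg.2 this)]

theorem lineMap_notMem_boundary (h : y ∈ cell 𝓛 x) {s : ℝ} (hs0 : 0 ≤ s) (hs1 : s < 1) :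
    AffineMap.lineMap x y s ∉ boundary 𝓛 x := fun hb => by
  obtain ⟨ℓ, hℓ, hx, h0⟩ := exists_of_mem_boundary hb
  rw [AffineMap.apply_lineMap, AffineMap.lineMap_apply_module, smul_eq_mul, smul_eq_mul] at h0
  rcases hx.lt_or_gt with hx | hx
  · have := (h ℓ hℓ).2 hx.le
    nlinarith [mul_pos (sub_pos.2 hs1) (neg_pos.2 hx), mul_nonneg hs0 (neg_nonneg.2 this)]
  · have := (h ℓ hℓ).1 hx.le
    nlinarith [mul_pos (sub_pos.2 hs1) hx, mul_nonneg hs0 this]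

/-- A ray from the center meets the boundary at most once, so only the apex of the cone is
collapsed. -/
theorem cone_injective {b b' : F} (hb : b ∈ boundary 𝓛 x) (hb' : b' ∈ boundary 𝓛 x) {s s' : I}
    (h : AffineMap.lineMap x b (s : ℝ) = AffineMap.lineMap x b' (s' : ℝ)) :
    s = s' ∧ (s = 0 ∨ b = b') := by
  wlog hss : s ≤ s' generalizing s s' b b'
  · obtain ⟨h1, h2⟩ := this hb' hb h.symm (le_of_not_ge hss)
    exact ⟨h1.symm, h2.imp (h1 ▸ id) Eq.symm⟩
  rcases eq_or_ne s' 0 with h0 | h0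
  · have : s = 0 := le_antisymm (h0 ▸ hss) s.2.1
    exact ⟨this.trans h0.symm, Or.inl this⟩
  have hs' : (0 : ℝ) < s' := unitInterval.pos_iff_ne_zero.2 h0
  have hb'' : b' = AffineMap.lineMap x b ((s : ℝ) / s') := by
    simp only [AffineMap.lineMap_apply, vsub_eq_sub, vadd_eq_add, add_left_inj] at h ⊢
    rw [div_eq_inv_mul, mul_smul, h, inv_smul_smul₀ hs'.ne', sub_add_cancel]
  have hle : (s : ℝ) / s' ≤ 1 := div_le_one_of_le₀ hss hs'.le
  rcases hle.lt_or_eq with hlt | heq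
  · exact absurd (hb'' ▸ hb') (lineMap_notMem_boundary hb.1 (div_nonneg s.2.1 hs'.le) hlt)
  · have h1 : s = s' := Subtype.ext ((div_eq_one_iff_eq hs'.ne').1 heq)
    rw [heq, AffineMap.lineMap_apply_one] at hb''
    exact ⟨h1, Or.inr hb''.symm⟩

end Algebra

section cone

variable {F : Type*} [AddCommGroup F] [Module ℝ F] [TopologicalSpace F]
  [IsTopologicalAddGroup F] [ContinuousSMul ℝ F] {𝓛 : Set (F →ᵃ[ℝ] ℝ)} {x : F}

/-- The parametrization of a cell as a cone over its boundary. -/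
noncomputable def cone (𝓛 : Set (F →ᵃ[ℝ] ℝ)) (x : F) : C(boundary 𝓛 x × I, cell 𝓛 x) where
  toFun z := ⟨AffineMap.lineMap x (z.1 : F) (z.2 : ℝ), lineMap_mem_cell z.1.2.1 z.2⟩
  continuous_toFun := by
    refine Continuous.subtype_mk ?_ _
    simp only [AffineMap.lineMap_apply_module]
    fun_prop

theorem cone_zero (b b' : boundary 𝓛 x) : cone 𝓛 x (b, 0) = cone 𝓛 x (b', 0) :=
  Subtype.ext (by simp [cone])

theorem coe_cone_one (b : boundary 𝓛 x) : (cone 𝓛 x (b, 1) : F) = b := by simp [cone]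

end cone

variable {F : Type*} [AddCommGroup F] [Module ℝ F] [FiniteDimensional ℝ F]
  [TopologicalSpace F] [IsTopologicalAddGroup F] [ContinuousSMul ℝ F] [T2Space F]
  {𝓛 : Set (F →ᵃ[ℝ] ℝ)} {x y : F}

theorem continuous_affineMap (ℓ : F →ᵃ[ℝ] ℝ) : Continuous ℓ :=
  AffineMap.continuous_linear_iff.1 ℓ.linear.continuous_of_finiteDimensional

theorem isClosed_cell : IsClosed (cell 𝓛 x) := by
  simp only [cell, ofPred_forall, ofPred_and]
  refine isClosed_biInter fun ℓ _ => ?_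
  have := continuous_affineMap ℓ
  exact (isClosed_iInter fun _ => isClosed_le continuous_const this).inter
    (isClosed_iInter fun _ => isClosed_le this continuous_const)

theorem isClosed_boundary (h𝓛 : 𝓛.Finite) : IsClosed (boundary 𝓛 x) := by
  have : boundary 𝓛 x = cell 𝓛 x ∩ ⋃ ℓ ∈ {ℓ ∈ 𝓛 | ℓ x ≠ 0}, {y | ℓ y = 0} := by
    ext y
    constructor
    · intro h
      obtain ⟨ℓ, hℓ, h1, h2⟩ := exists_of_mem_boundary h
      exact ⟨h.1, mem_biUnion (show ℓ ∈ {ℓ ∈ 𝓛 | ℓ x ≠ 0} from ⟨hℓ, h1⟩) h2⟩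
    · rintro ⟨h, h'⟩
      obtain ⟨ℓ, hℓ, h2⟩ := mem_iUnion₂.1 h'
      exact mem_boundary_of_eq_zero h hℓ.1 hℓ.2 h2
  rw [this]
  exact isClosed_cell.inter ((h𝓛.subset (sep_subset _ _)).isClosed_biUnion fun ℓ _ =>
    isClosed_eq (continuous_affineMap ℓ) continuous_const)

theorem Saturated.isClosed (h𝓛 : 𝓛.Finite) {Y : Set F} (hY : Saturated 𝓛 Y) : IsClosed Y := by
  have : Y = ⋃ D ∈ {D ∈ range (cell 𝓛) | D ⊆ Y}, D := by
    refine Subset.antisymm (fun x hx => ?_) (iUnion₂_subset fun D hD => hD.2)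
    exact mem_biUnion (show cell 𝓛 x ∈ {D ∈ range (cell 𝓛) | D ⊆ Y} from ⟨⟨x, rfl⟩, hY x hx⟩)
      mem_cell_self
  rw [this]
  refine ((finite_range_cell h𝓛).subset (sep_subset _ _)).isClosed_biUnion ?_
  rintro _ ⟨⟨x, rfl⟩, -⟩
  exact isClosed_cell

/-- Each point of a compact cell is on a segment from the center to a boundary point. -/
theorem exists_mem_boundary (h𝓛 : 𝓛.Finite) (hc : IsCompact (cell 𝓛 x)) (hy : y ∈ cell 𝓛 x)
    (hne : y ≠ x) : ∃ b ∈ boundary 𝓛 x, ∃ s : I, y = AffineMap.lineMap x b (s : ℝ) := by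
  have hcont : Continuous fun r : ℝ => AffineMap.lineMap x y r := by
    simp only [AffineMap.lineMap_apply_module]
    fun_prop
  let S : Set ℝ := {r | AffineMap.lineMap x y r ∈ cell 𝓛 x}
  have hS : IsClosed S := isClosed_cell.preimage hcont
  have h1 : (1 : ℝ) ∈ S := by simpa [S] using hy
  have hbdd : BddAbove S := by
    -- A functional that is nonzero on `y - x` recovers the parameter `r` from the point of the ray,
    -- so compactness bounds `r`.
    obtain ⟨f, hf⟩ : ∃ f : F →ₗ[ℝ] ℝ, f (y - x) ≠ 0 := by
      by_contra! h
      exact sub_ne_zero.2 hne ((Module.forall_dual_apply_eq_zero_iff ℝ _).1 h)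
    have hfc := f.continuous_of_finiteDimensional
    obtain ⟨R, hR⟩ := (hc.image (f := fun z => (f (y - x))⁻¹ * (f z - f x)) (by fun_prop)).bddAbove
    refine ⟨R, fun r hr => ?_⟩
    have := hR (mem_image_of_mem _ hr)
    simp only [AffineMap.lineMap_apply, vsub_eq_sub, vadd_eq_add, map_add, map_smul,
      add_sub_cancel_right, smul_eq_mul] at this
    rwa [mul_comm r, inv_mul_cancel_left₀ hf] at this
  have hR : sSup S ∈ S := hS.csSup_mem ⟨1, h1⟩ hbdd
  have hR1 : 1 ≤ sSup S := le_csSup hbdd h1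
  have hR0 : (0 : ℝ) < sSup S := by linarith
  refine ⟨AffineMap.lineMap x y (sSup S), ?_, ⟨(sSup S)⁻¹, by positivity, inv_le_one_of_one_le₀ hR1⟩,
    ?_⟩
  · by_contra hb
    -- If the last point of the ray in the cell were not on the boundary, all sign conditions there
    -- would be strict or hold along the whole ray, so the ray could be continued in the cell.
    have hnz : ∀ ℓ ∈ 𝓛, ℓ x ≠ 0 → ℓ (AffineMap.lineMap x y (sSup S)) ≠ 0 := fun ℓ hℓ hx h0 =>
      hb (mem_boundary_of_eq_zero hR hℓ hx h0)
    have hev : ∀ᶠ r in 𝓝 (sSup S), r ∈ S := by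
      have : ∀ ℓ ∈ 𝓛, ∀ᶠ r in 𝓝 (sSup S), (0 ≤ ℓ x → 0 ≤ ℓ (AffineMap.lineMap x y r)) ∧
          (ℓ x ≤ 0 → ℓ (AffineMap.lineMap x y r) ≤ 0) := by
        intro ℓ hℓ
        have hℓc : Continuous fun r : ℝ => ℓ (AffineMap.lineMap x y r) :=
          (continuous_affineMap ℓ).comp hcont
        rcases lt_trichotomy (ℓ x) 0 with hx | hx | hx
        · have h' := lt_of_le_of_ne ((hR ℓ hℓ).2 hx.le) (hnz ℓ hℓ hx.ne)
          filter_upwards [hℓc.continuousAt.eventually_lt continuousAt_const h'] with r hr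
          exact ⟨fun h => absurd h hx.not_ge, fun _ => hr.le⟩
        · have h0 : ℓ y = 0 := eq_zero_of_mem_cell hy hℓ hx
          refine Filter.Eventually.of_forall fun r => ?_
          simp [AffineMap.apply_lineMap, hx, h0]
        · have h' := lt_of_le_of_ne ((hR ℓ hℓ).1 hx.le) (hnz ℓ hℓ hx.ne').symm
          filter_upwards [continuousAt_const.eventually_lt hℓc.continuousAt h'] with r hr
          exact ⟨fun _ => hr.le, fun h => absurd h hx.not_ge⟩
      filter_upwards [(Filter.eventually_all_finite h𝓛).2 this] with r hr
      exact hr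
    obtain ⟨ε, hε, hball⟩ := Metric.eventually_nhds_iff.1 hev
    have : sSup S + ε / 2 ∈ S := hball (by simp [abs_of_pos hε, hε])
    linarith [le_csSup hbdd this]
  · simp only [AffineMap.lineMap_apply, vsub_eq_sub, vadd_eq_add, add_sub_cancel_right]
    rw [inv_smul_smul₀ hR0.ne', sub_add_cancel]

theorem compactSpace_boundary (h𝓛 : 𝓛.Finite) (hc : IsCompact (cell 𝓛 x)) :
    CompactSpace (boundary 𝓛 x) :=
  isCompact_iff_compactSpace.1 (hc.of_isClosed_subset (isClosed_boundary h𝓛) fun _ h => h.1)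

/-- A continuous surjection from a compact space onto a Hausdorff one. A nonempty boundary is needed
for the center to be attained. -/
theorem isQuotientMap_cone (h𝓛 : 𝓛.Finite) (hc : IsCompact (cell 𝓛 x))
    (hne : (boundary 𝓛 x).Nonempty) : Topology.IsQuotientMap (cone 𝓛 x) := by
  have := compactSpace_boundary h𝓛 hc
  refine Topology.IsQuotientMap.of_surjective_continuous ?_ (cone 𝓛 x).continuous
  rintro ⟨y, hy⟩
  rcases eq_or_ne y x with rfl | h
  · obtain ⟨b, hb⟩ := hne
    exact ⟨(⟨b, hb⟩, 0), Subtype.ext (by simp [cone])⟩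
  · obtain ⟨b, hb, s, hs⟩ := exists_mem_boundary h𝓛 hc hy h
    exact ⟨(⟨b, hb⟩, s), Subtype.ext hs.symm⟩

theorem cell_subset_singleton (h𝓛 : 𝓛.Finite) (hc : IsCompact (cell 𝓛 x))
    (hne : ¬ (boundary 𝓛 x).Nonempty) : cell 𝓛 x ⊆ {x} := fun y hy => by
  by_contra h
  obtain ⟨b, hb, -⟩ := exists_mem_boundary h𝓛 hc hy h
  exact hne ⟨b, hb⟩

/-- A continuous map on `B × [0,1] × T` that is constant at the apex descends to the cell. -/
theorem exists_descend (h𝓛 : 𝓛.Finite) (hc : IsCompact (cell 𝓛 x))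
    (hne : (boundary 𝓛 x).Nonempty) {T Z : Type*} [TopologicalSpace T] [CompactSpace T] [T2Space T]
    [TopologicalSpace Z] (f : C((boundary 𝓛 x × I) × T, Z))
    (hf : ∀ b b' t, f ((b, 0), t) = f ((b', 0), t)) :
    ∃ f' : C(cell 𝓛 x × T, Z), ∀ z t, f' (cone 𝓛 x z, t) = f (z, t) := by
  have := compactSpace_boundary h𝓛 hc
  have hq : Topology.IsQuotientMap (Prod.map (cone 𝓛 x) (id : T → T)) :=
    Topology.IsQuotientMap.of_surjective_continuous
      ((isQuotientMap_cone h𝓛 hc hne).surjective.prodMap Function.surjective_id)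
      ((cone 𝓛 x).continuous.prodMap continuous_id)
  let q : C((boundary 𝓛 x × I) × T, cell 𝓛 x × T) := ⟨_, hq.continuous⟩
  have hq' : Topology.IsQuotientMap q := hq
  have hfac : Function.FactorsThrough f q := by
    rintro ⟨⟨b, s⟩, t⟩ ⟨⟨b', s'⟩, t'⟩ h
    obtain ⟨h1, rfl⟩ := Prod.ext_iff.1 h
    obtain ⟨rfl, rfl | h2⟩ := cone_injective b.2 b'.2 (congrArg Subtype.val h1)
    · exact hf _ _ _
    · rw [Subtype.ext h2]; rfl
  exact ⟨hq'.lift f hfac, fun z t =>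
    congrArg (fun k : C(_, Z) => k (z, t)) (hq'.lift_comp f hfac)⟩

/-- Refining an arrangement by a fine grid, the cells become small. -/
theorem exists_refinement (h𝓛 : 𝓛.Finite) {Y : Set F} (hY : IsCompact Y) {O : F → Set F}
    (hO : ∀ x ∈ Y, IsOpen (O x)) (hx : ∀ x ∈ Y, x ∈ O x) :
    ∃ 𝓛', 𝓛 ⊆ 𝓛' ∧ 𝓛'.Finite ∧ ∀ x ∈ Y, ∃ z ∈ Y, cell 𝓛' x ⊆ O z := by
  let e := (Module.finBasis ℝ F).equivFunL
  obtain ⟨δ, hδ, hball⟩ := lebesgue_number_lemma_of_metric (c := fun z : Y => e.symm ⁻¹' O z)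
    (hY.image e.continuous) (fun z => (hO z z.2).preimage e.symm.continuous)
    (by rintro _ ⟨z, hz, rfl⟩; exact mem_iUnion.2 ⟨⟨z, hz⟩, by simpa using hx z hz⟩)
  obtain ⟨R, hR⟩ := (hY.image e.continuous).isBounded.exists_norm_le
  -- Grid walls at distance `δ / 2`, with `δ` a Lebesgue number, trap each coordinate in an interval
  -- of length `δ / 2 < δ`. The extra `1` makes the wall above the largest coordinate available.
  let K : ℤ := ⌈R / (δ / 2)⌉ + 1
  let grid : Fin (Module.finrank ℝ F) × ℤ → (F →ᵃ[ℝ] ℝ) := fun j =>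
    ((LinearMap.proj j.1).comp e.toLinearMap : F →ₗ[ℝ] ℝ).toAffineMap +
      AffineMap.const ℝ F (-(j.2 * (δ / 2)))
  have hgrid : ∀ i k z, grid (i, k) z = e z i - k * (δ / 2) := fun i k z => by
    simp [grid, sub_eq_add_neg]
  refine ⟨𝓛 ∪ grid '' (univ ×ˢ Icc (-K) K), subset_union_left,
    h𝓛.union ((finite_univ.prod (finite_Icc _ _)).image _), fun x hxY => ?_⟩
  obtain ⟨z, hz⟩ := hball (e x) (mem_image_of_mem _ hxY)
  refine ⟨z, z.2, fun y hy => ?_⟩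
  suffices h : e y ∈ Metric.ball (e x) δ by simpa using hz h
  rw [Metric.mem_ball, dist_pi_lt_iff hδ]
  intro i
  have hxi : |e x i| ≤ R := (norm_le_pi_norm (e x) i).trans (hR _ (mem_image_of_mem _ hxY))
  rw [abs_le] at hxi
  set k := ⌊e x i / (δ / 2)⌋
  have hη : 0 < δ / 2 := by positivity
  have h1 : (k : ℝ) * (δ / 2) ≤ e x i := (le_div_iff₀ hη).1 (Int.floor_le _)
  have h2 : e x i ≤ ((k + 1 : ℤ) : ℝ) * (δ / 2) := by
    push_cast
    exact ((div_lt_iff₀ hη).1 (Int.lt_floor_add_one _)).le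
  have hk1 : -K ≤ k := by
    refine Int.le_floor.2 ?_
    rw [le_div_iff₀ hη]
    have := (div_le_iff₀ hη).1 (Int.le_ceil (R / (δ / 2)))
    simp only [K]
    push_cast
    nlinarith
  have hk2 : k + 1 ≤ K := by
    refine add_le_add_left (Int.floor_le_ceil _ |>.trans (Int.ceil_le_ceil ?_)) 1
    exact div_le_div_of_nonneg_right hxi.2 hη.le
  have hy1 := (hy (grid (i, k)) (Or.inr ⟨(i, k), ⟨mem_univ _, hk1, by omega⟩, rfl⟩)).1
  have hy2 := (hy (grid (i, k + 1)) (Or.inr ⟨(i, k + 1), ⟨mem_univ _, by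
    change -K ≤ k + 1; omega, hk2⟩, rfl⟩)).2
  rw [hgrid, hgrid] at hy1 hy2
  have hy1 := hy1 (sub_nonneg.2 h1)
  have hy2 := hy2 (sub_nonpos.2 h2)
  push_cast at hy2 h2
  rw [Real.dist_eq, abs_lt]
  constructor <;> linarith

end Arrangement

/-! ### Compression of maps on polyhedra into some `M_β` -/

namespace DirectedFamily

open scoped unitInterval Topology
open Set Arrangement

variable {A : Type u₁} [Preorder A] {M : Type u₂} [TopologicalSpace M] {D : DirectedFamily A M}

/-- On the set `s`, the map `f` is a continuous map into `M_α`. -/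
def LiftsOn (D : DirectedFamily A M) {X : Type*} [TopologicalSpace X] (α : A) (s : Set X)
    (f : X → M) : Prop :=
  ∃ g : C(s, D.Step α), ∀ x, D.incl α (g x) = f x

namespace LiftsOn

variable {X : Type*} [TopologicalSpace X] {α β : A} {s t : Set X} {f f' : X → M}

theorem congr (h : D.LiftsOn α s f) (hf : ∀ x ∈ s, f' x = f x) : D.LiftsOn α s f' :=
  h.imp fun _ hg x => (hg x).trans (hf x x.2).symm

theorem mono (h : D.LiftsOn α s f) (hst : t ⊆ s) : D.LiftsOn α t f := by
  obtain ⟨g, hg⟩ := h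
  exact ⟨g.comp ⟨inclusion hst, continuous_inclusion hst⟩, fun x => hg _⟩

theorem trans (h : D.LiftsOn α s f) (hαβ : α ≤ β) : D.LiftsOn β s f := by
  obtain ⟨g, hg⟩ := h
  exact ⟨(D.trans hαβ).comp g, hg⟩

/-- The topology of `M_α` may be finer than that induced from `M`, so continuity into `M_α` has to
be pasted over a finite closed cover. The local lifts agree because `f` determines them. -/
theorem iUnion {ι : Type*} [Finite ι] {s : ι → Set X} (hs : ∀ i, IsClosed (s i))
    (h : ∀ i, D.LiftsOn α (s i) f) : D.LiftsOn α (⋃ i, s i) f := by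
  choose g hg using h
  have hmem : ∀ x ∈ ⋃ i, s i, f x ∈ D.carrier α := fun x hx => by
    obtain ⟨i, hi⟩ := mem_iUnion.1 hx
    exact hg i ⟨x, hi⟩ ▸ (g i ⟨x, hi⟩).2
  let G : (⋃ i, s i : Set X) → D.Step α := fun x => ⟨f x, hmem x x.2⟩
  suffices hG : Continuous G from ⟨⟨G, hG⟩, fun _ => rfl⟩
  refine (locallyFinite_of_finite fun i => ((↑) : (⋃ i, s i : Set X) → X) ⁻¹' s i).continuous
    ?_ (fun i => (hs i).preimage continuous_subtype_val) fun i => ?_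
  · rw [← preimage_iUnion, Subtype.coe_preimage_self]
  · rw [continuousOn_iff_continuous_domRestrict]
    have : Continuous fun x : (((↑) : (⋃ i, s i : Set X) → X) ⁻¹' s i) => g i ⟨x.1.1, x.2⟩ := by
      fun_prop
    exact this.congr fun x => Subtype.ext (hg i _)

theorem union (hs : IsClosed s) (ht : IsClosed t) (h : D.LiftsOn α s f)
    (h' : D.LiftsOn α t f) : D.LiftsOn α (s ∪ t) f := by
  rw [union_eq_iUnion]
  exact iUnion (by simp [hs, ht]) (by simp [h, h'])

theorem const {q : M} (hq : q ∈ D.carrier α) (hf : ∀ x ∈ s, f x = q) : D.LiftsOn α s f :=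
  ⟨.const _ ⟨q, hq⟩, fun x => (hf x x.2).symm⟩

end LiftsOn

variable {F : Type u₅} [AddCommGroup F] [Module ℝ F] [FiniteDimensional ℝ F]
  [TopologicalSpace F] [IsTopologicalAddGroup F] [ContinuousSMul ℝ F] [T2Space F]

/-- A small homotopy on the boundary of a cell, with end in `M_α`, extends to the cell. -/
theorem IsFillable.exists_cell_extension {W' W : Set M}
    (hfill : IsFillable.{u₁, u₂, u₅} D W' W) {𝓛 : Set (F →ᵃ[ℝ] ℝ)} (h𝓛 : 𝓛.Finite) {x : F}
    (hc : IsCompact (cell 𝓛 x)) {f : F → M} (hf : ContinuousOn f (cell 𝓛 x))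
    (hfW : ∀ y ∈ cell 𝓛 x, f y ∈ W') (α : A) {h : F × I → M}
    (hh : ContinuousOn h (boundary 𝓛 x ×ˢ univ)) (h0 : ∀ y ∈ boundary 𝓛 x, h (y, 0) = f y)
    (hhW : ∀ y ∈ boundary 𝓛 x, ∀ t, h (y, t) ∈ W')
    (hlift : D.LiftsOn α (boundary 𝓛 x) fun y => h (y, 1)) :
    ∃ β, α ≤ β ∧ ∃ H : F × I → M, ContinuousOn H (cell 𝓛 x ×ˢ univ) ∧
      (∀ y ∈ cell 𝓛 x, H (y, 0) = f y) ∧ (∀ y ∈ boundary 𝓛 x, ∀ t, H (y, t) = h (y, t)) ∧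
      (∀ y ∈ cell 𝓛 x, ∀ t, H (y, t) ∈ W) ∧ D.LiftsOn β (cell 𝓛 x) fun y => H (y, 1) := by
  classical
  by_cases hne : (boundary 𝓛 x).Nonempty
  · have := compactSpace_boundary h𝓛 hc
    have : Nonempty (boundary 𝓛 x) := hne.to_subtype
    obtain ⟨g, hg⟩ := hlift
    let γ : C(boundary 𝓛 x × I, M) := ⟨fun z => f (cone 𝓛 x z),
      hf.comp_continuous (continuous_subtype_val.comp (cone 𝓛 x).continuous) fun z =>
        (cone 𝓛 x z).2⟩
    let h' : C(boundary 𝓛 x × I, M) := ⟨fun z => h (z.1, z.2),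
      hh.comp_continuous (by fun_prop) fun z => ⟨z.1.2, mem_univ _⟩⟩
    obtain ⟨β, hαβ, H, G, hHW, hH0, hH1, hHa, hG⟩ := hfill.exists_extension _ γ h' α g
      (fun z => hfW _ (cone 𝓛 x z).2) (fun z => hhW _ z.1.2 _)
      (fun b b' => congrArg (fun y : cell 𝓛 x => f y) (cone_zero b b'))
      (fun b => by simp [γ, h', coe_cone_one, h0 _ b.2]) hg
    obtain ⟨H', hH'⟩ := exists_descend h𝓛 hc hne H hHa
    -- The lift `G` is constant at the apex because `H` is and `M_β → M` is injective.
    obtain ⟨G', hG'⟩ := exists_descend h𝓛 hc hne (T := Unit) (G.comp ⟨Prod.fst, continuous_fst⟩)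
      (fun b b' t => Subtype.ext ((hG _).trans ((hHa b b' 1).trans (hG _).symm)))
    have hsurj := (isQuotientMap_cone h𝓛 hc hne).surjective
    refine ⟨β, hαβ, fun p => if hp : p.1 ∈ cell 𝓛 x then H' (⟨p.1, hp⟩, p.2) else f x, ?_, ?_, ?_,
      ?_, ?_⟩
    · rw [continuousOn_iff_continuous_domRestrict]
      have : Continuous fun p : ↥(cell 𝓛 x ×ˢ (univ : Set I)) => H' (⟨p.1.1, p.2.1⟩, p.1.2) := by
        fun_prop
      exact this.congr fun p => by
        change _ = dite _ _ _
        rw [dif_pos p.2.1]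
    · intro y hy
      obtain ⟨z, hz⟩ := hsurj ⟨y, hy⟩
      simp only [dif_pos hy]
      rw [← hz, hH', hH0]
      simp [γ, hz]
    · intro y hy t
      have hz : cone 𝓛 x (⟨y, hy⟩, 1) = ⟨y, hy.1⟩ := Subtype.ext (coe_cone_one _)
      simp only [dif_pos hy.1]
      rw [← hz, hH', hH1]
      rfl
    · intro y hy t
      obtain ⟨z, hz⟩ := hsurj ⟨y, hy⟩
      simp only [dif_pos hy]
      rw [← hz, hH']
      exact hHW _
    · refine ⟨G'.comp ⟨fun y => (y, ()), by fun_prop⟩, fun y => ?_⟩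
      obtain ⟨z, rfl⟩ := hsurj y
      simp only [Subtype.coe_prop, dif_pos, Subtype.coe_eta]
      rw [hH', ← hG]
      exact congrArg (D.incl β) (hG' z ())
  -- A cell without boundary is a vertex, which is moved along a path ending in some `M_β`.
  · have hsub := cell_subset_singleton h𝓛 hc hne
    obtain ⟨β, hαβ, P, hP0, hP1, hPW⟩ := hfill.exists_path (f x) (hfW x mem_cell_self) α
    refine ⟨β, hαβ, fun p => P p.2, by fun_prop, fun y hy => ?_,
      fun y hy => (hne ⟨y, hy⟩).elim, fun _ _ => hPW, .const hP1 fun _ _ => rfl⟩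
    rw [hsub hy]
    exact hP0

variable [IsDirectedOrder A]

/-- A continuous map on a compact union of cells which, on a subcomplex, is a continuous map into
some `M_α` can be deformed, by a small homotopy relative to the subcomplex, to a continuous map
into some `M_β`. -/
theorem exists_compression (hdense : Dense D.union)
    (hM : AdmitsWellFilledCharts.{u₁, u₂, u₃, u₄} D) (k : ℕ) :
    ∀ {𝓛 : Set (F →ᵃ[ℝ] ℝ)}, 𝓛.Finite → ∀ {Y₀ Y : Set F}, Saturated 𝓛 Y₀ → Saturated 𝓛 Y →
      Y₀ ⊆ Y → IsCompact Y → (∀ x ∈ Y, x ∉ Y₀ → dim 𝓛 x < k) →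
      ∀ {f : F → M}, ContinuousOn f Y → ∀ {α : A}, D.LiftsOn α Y₀ f →
      ∀ {𝒲 : Set (F × M)}, IsOpen 𝒲 → (∀ x ∈ Y, (x, f x) ∈ 𝒲) →
      ∃ β, α ≤ β ∧ ∃ H : F × I → M, ContinuousOn H (Y ×ˢ univ) ∧
        (∀ x ∈ Y, H (x, 0) = f x) ∧ (∀ x ∈ Y₀, ∀ t, H (x, t) = f x) ∧
        (∀ x ∈ Y, ∀ t, (x, H (x, t)) ∈ 𝒲) ∧ D.LiftsOn β Y fun x => H (x, 1) := by
  classical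
  induction k with
  | zero =>
    intro 𝓛 _ Y₀ Y _ _ h₀ _ hdim f hf α hα 𝒲 _ hgraph
    refine ⟨α, le_rfl, fun p => f p.1, hf.comp continuousOn_fst fun p hp => hp.1,
      fun _ _ => rfl, fun _ _ _ => rfl, fun x hx _ => hgraph x hx, hα.mono fun x hx => ?_⟩
    by_contra h
    exact absurd (hdim x hx h) (Nat.not_lt_zero _)
  | succ k ih =>
    intro 𝓛 h𝓛 Y₀ Y hY₀ hY h₀ hYc hdim f hf α hα 𝒲 h𝒲 hgraph
    -- local data
    have hloc : ∀ x ∈ Y, ∃ (O : Set F) (W W' : Set M), IsOpen O ∧ x ∈ O ∧ O ×ˢ W ⊆ 𝒲 ∧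
        IsOpen W' ∧ (∀ y ∈ O, y ∈ Y → f y ∈ W') ∧ IsFillable.{u₁, u₂, u₅} D W' W := by
      intro x hx
      obtain ⟨O, W, hO, hW, hxO, hxW, hOW⟩ := isOpen_prod_iff.1 h𝒲 _ _ (hgraph x hx)
      obtain ⟨W', hW', hxW', hfill⟩ := exists_isFillable.{u₁, u₂, u₃, u₄, u₅} hdense hM (f x) hW hxW
      obtain ⟨P, hP, hPY⟩ := continuousOn_iff'.1 hf W' hW'
      refine ⟨O ∩ P, W, W', hO.inter hP, ⟨hxO, ?_⟩, fun p hp => hOW ⟨hp.1.1, hp.2⟩, hW',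
        fun y hy hyY => ?_, hfill⟩
      · exact (hPY.subset ⟨hxW', hx⟩).1
      · exact (hPY.superset ⟨hy.2, hyY⟩).1
    choose! O W W' hO hxO hOW hW' hfW' hfill using hloc
    obtain ⟨𝓛', hsub, h𝓛', href⟩ := exists_refinement h𝓛 hYc hO hxO
    have hY' := hY.mono hsub
    have hcells : ∀ E ∈ cell 𝓛' '' Y, ∃ z ∈ Y, E ⊆ O z := by
      rintro _ ⟨x, hx, rfl⟩
      exact href x hx
    -- The local data are attached to cells rather than points, so only finitely many smallness
    -- conditions arise.
    choose! z hzY hzO using hcells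
    have hfin : (cell 𝓛' '' Y).Finite := (finite_range_cell h𝓛').subset (image_subset_range _ _)
    have hclosed : ∀ E ∈ cell 𝓛' '' Y, IsClosed E := by
      rintro _ ⟨x, -, rfl⟩
      exact isClosed_cell
    -- the lower skeleton
    let Z : Set F := Y₀ ∪ {x ∈ Y | dim 𝓛' x < k}
    have hZY : Z ⊆ Y := union_subset h₀ (sep_subset _ _)
    have hZ : Saturated 𝓛' Z := (hY₀.mono hsub).union fun x hx y hy =>
      ⟨hY' x hx.1 hy, (dim_le_of_mem_cell hy).trans_lt hx.2⟩
    -- The control for the lower skeleton: over each cell `E` the homotopy must stay in the small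
    -- set `W' (z E)`, from which it can be extended over cells within `W (z E)`.
    let 𝒲' : Set (F × M) := ⋂ E ∈ cell 𝓛' '' Y, Prod.fst ⁻¹' Eᶜ ∪ Prod.snd ⁻¹' W' (z E)
    have h𝒲' : IsOpen 𝒲' := hfin.isOpen_biInter fun E hE =>
      ((hclosed E hE).isOpen_compl.preimage continuous_fst).union
        ((hW' _ (hzY E hE)).preimage continuous_snd)
    have hmem𝒲' : ∀ {y m}, (y, m) ∈ 𝒲' → ∀ E ∈ cell 𝓛' '' Y, y ∈ E → m ∈ W' (z E) :=
      fun h E hE hy => (mem_iInter₂.1 h E hE).resolve_left fun h' => h' hy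
    have hfE : ∀ E ∈ cell 𝓛' '' Y, ∀ y ∈ E, f y ∈ W' (z E) := by
      rintro _ ⟨x, hx, rfl⟩ y hy
      exact hfW' _ (hzY _ ⟨x, hx, rfl⟩) y (hzO _ ⟨x, hx, rfl⟩ hy) (hY' x hx hy)
    obtain ⟨β₀, hαβ₀, H₀, hH₀c, hH₀0, hH₀r, hH₀𝒲, hH₀l⟩ := ih h𝓛' (hY₀.mono hsub) hZ
      subset_union_left (hYc.of_isClosed_subset (hZ.isClosed h𝓛') hZY)
      (fun x hx hx₀ => (hx.resolve_left hx₀).2) (hf.mono hZY) hα h𝒲' fun x hx => by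
        refine mem_iInter₂.2 fun E hE => ?_
        by_cases hxE : x ∈ E
        exacts [Or.inr (hfE E hE x hxE), Or.inl hxE]
    -- the top cells
    have hbdry : ∀ x ∈ Y \ Z, ∀ y, y ∈ boundary 𝓛' x ↔ y ∈ cell 𝓛' x ∧ y ∈ Z := by
      refine fun x hx y => ⟨fun hy => ⟨hy.1, Or.inr ⟨hY' x hx.1 hy.1, ?_⟩⟩,
        fun hy => ⟨hy.1, fun h => hx.2 (hZ y hy.2 h)⟩⟩
      have h1 := hdim x hx.1 fun h => hx.2 (Or.inl h)
      have h2 : dim 𝓛' x ≤ dim 𝓛 x := dim_anti hsub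
      have h3 := dim_lt_of_mem_boundary hy
      omega
    have htop : ∀ E ∈ cell 𝓛' '' (Y \ Z), ∃ β, β₀ ≤ β ∧ ∃ H : F × I → M,
        ContinuousOn H (E ×ˢ univ) ∧ (∀ y ∈ E, H (y, 0) = f y) ∧
        (∀ y ∈ E, y ∈ Z → ∀ t, H (y, t) = H₀ (y, t)) ∧ (∀ y ∈ E, ∀ t, H (y, t) ∈ W (z E)) ∧
        D.LiftsOn β E fun y => H (y, 1) := by
      rintro _ ⟨x, hx, rfl⟩
      have hxY : cell 𝓛' x ∈ cell 𝓛' '' Y := ⟨x, hx.1, rfl⟩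
      have hbZ : boundary 𝓛' x ⊆ Z := fun y hy => ((hbdry x hx y).1 hy).2
      obtain ⟨β, hβ, H, h1, h2, h3, h4, h5⟩ := (hfill _ (hzY _ hxY)).exists_cell_extension h𝓛'
        (hYc.of_isClosed_subset isClosed_cell (hY' x hx.1)) (hf.mono (hY' x hx.1))
        (hfE _ hxY) β₀ (hH₀c.mono (prod_mono hbZ Subset.rfl))
        (fun y hy => hH₀0 y (hbZ hy)) (fun y hy t => hmem𝒲' (hH₀𝒲 y (hbZ hy) t) _ hxY hy.1)
        (hH₀l.mono hbZ)
      exact ⟨β, hβ, H, h1, h2, fun y hy hyZ => h3 y ((hbdry x hx y).2 ⟨hy, hyZ⟩), h4, h5⟩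
    have : Nonempty A := ⟨α⟩
    have : Nonempty (F × I → M) := ⟨H₀⟩
    choose! β hβ H hHc hH0 hHZ hHW hHl using htop
    have hfin' : (cell 𝓛' '' (Y \ Z)).Finite := hfin.subset (image_mono sdiff_subset)
    have hsub' : cell 𝓛' '' (Y \ Z) ⊆ cell 𝓛' '' Y := image_mono sdiff_subset
    obtain ⟨β₁, hβ₁⟩ := ((hfin'.image β).insert β₀).bddAbove
    -- gluing
    let K : F × I → M := fun p => if p.1 ∈ Z then H₀ p else H (cell 𝓛' p.1) p
    have hKZ : ∀ y ∈ Z, ∀ t, K (y, t) = H₀ (y, t) := fun y hy t => if_pos hy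
    have hKE : ∀ E ∈ cell 𝓛' '' (Y \ Z), ∀ y ∈ E, ∀ t, K (y, t) = H E (y, t) := by
      intro E hE y hy t
      by_cases hyZ : y ∈ Z
      · rw [hKZ y hyZ, hHZ E hE y hy hyZ]
      · obtain ⟨x, hx, rfl⟩ := hE
        have hxy : x ∈ cell 𝓛' y := by
          by_contra h
          exact hyZ ((hbdry x hx y).1 ⟨hy, h⟩).2
        have : cell 𝓛' y = cell 𝓛' x :=
          Subset.antisymm (cell_subset_cell hy) (cell_subset_cell hxy)
        simp only [K, if_neg hyZ, this]
    have hcover : Y = Z ∪ ⋃ E : cell 𝓛' '' (Y \ Z), (E : Set F) := by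
      refine Subset.antisymm (fun x hx => ?_) (union_subset hZY (iUnion_subset ?_))
      · by_cases hxZ : x ∈ Z
        · exact Or.inl hxZ
        · exact Or.inr (mem_iUnion.2 ⟨⟨_, x, ⟨hx, hxZ⟩, rfl⟩, mem_cell_self⟩)
      · rintro ⟨_, x, hx, rfl⟩
        exact hY' x hx.1
    have hcases : ∀ x ∈ Y, x ∈ Z ∨ ∃ E ∈ cell 𝓛' '' (Y \ Z), x ∈ E := fun x hx => by
      by_cases hxZ : x ∈ Z
      exacts [Or.inl hxZ, Or.inr ⟨_, ⟨x, ⟨hx, hxZ⟩, rfl⟩, mem_cell_self⟩]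
    have : Finite (cell 𝓛' '' (Y \ Z)) := hfin'
    have hEc : ∀ E : cell 𝓛' '' (Y \ Z), IsClosed (E : Set F) := fun E => hclosed E (hsub' E.2)
    have hZc : IsClosed Z := hZ.isClosed h𝓛'
    refine ⟨β₁, hαβ₀.trans (hβ₁ (mem_insert _ _)), K, ?_, ?_, ?_, ?_, ?_⟩
    · rw [hcover, union_prod, iUnion_prod_const]
      refine ContinuousOn.union_of_isClosed ?_ ?_ (hZc.prod isClosed_univ)
        (isClosed_iUnion_of_finite fun E => (hEc E).prod isClosed_univ)
      · exact hH₀c.congr fun p hp => hKZ p.1 hp.1 p.2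
      · refine (locallyFinite_of_finite _).continuousOn_iUnion
          (fun E => (hEc E).prod isClosed_univ) fun E => ?_
        exact (hHc E E.2).congr fun p hp => hKE E E.2 p.1 hp.1 p.2
    · intro x hx
      rcases hcases x hx with hxZ | ⟨E, hE, hxE⟩
      · rw [hKZ x hxZ, hH₀0 x hxZ]
      · rw [hKE E hE x hxE, hH0 E hE x hxE]
    · intro x hx t
      rw [hKZ x (Or.inl hx), hH₀r x hx]
    · intro x hx t
      have key : ∀ E ∈ cell 𝓛' '' Y, x ∈ E → K (x, t) ∈ W (z E) → (x, K (x, t)) ∈ 𝒲 :=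
        fun E hE hxE hK => hOW _ (hzY E hE) ⟨hzO E hE hxE, hK⟩
      rcases hcases x hx with hxZ | ⟨E, hE, hxE⟩
      · refine key _ ⟨x, hx, rfl⟩ mem_cell_self ?_
        rw [hKZ x hxZ]
        exact (hfill _ (hzY _ ⟨x, hx, rfl⟩)).subset
          (hmem𝒲' (hH₀𝒲 x hxZ t) _ ⟨x, hx, rfl⟩ mem_cell_self)
      · refine key E (hsub' hE) hxE ?_
        rw [hKE E hE x hxE]
        exact hHW E hE x hxE t
    · rw [hcover]
      refine .union hZc (isClosed_iUnion_of_finite hEc) ?_ (.iUnion hEc fun E => ?_)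
      · exact (hH₀l.trans (hβ₁ (mem_insert _ _))).congr fun x hx => hKZ x hx 1
      · exact ((hHl E E.2).trans (hβ₁ (mem_insert_of_mem _ ⟨E, E.2, rfl⟩))).congr
          fun x hx => hKE E E.2 x hx 1

end DirectedFamily

/-! ### A criterion for direct limits of sets -/

theorem IsSetDirectLimit.of_surjective_of_injective {ι : Type u₁} [Preorder ι]
    [IsDirectedOrder ι] {G : ι → Type u₂} {f : ∀ ⦃i j : ι⦄, i ≤ j → G i → G j}
    [DirectedSystem G f] {L : Type u₃} {μ : ∀ i, G i → L}
    (cone : ∀ ⦃i j : ι⦄ (h : i ≤ j), μ j ∘ f h = μ i) (surj : ∀ l, ∃ i x, μ i x = l)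
    (inj : ∀ i x y, μ i x = μ i y → ∃ j, ∃ h : i ≤ j, f h x = f h y) :
    IsSetDirectLimit.{u₁, u₂, u₃, z} f μ where
  cone := cone
  universal T g hg := by
    have hcone : ∀ ⦃i j : ι⦄ (h : i ≤ j) x, μ j (f h x) = μ i x := fun i j h x =>
      congrFun (cone h) x
    have hgc : ∀ ⦃i j : ι⦄ (h : i ≤ j) x, g j (f h x) = g i x := fun i j h x => congrFun (hg h) x
    choose i x hx using surj
    -- Well-definedness of the factorization: two representatives are moved to a common index and
    -- then identified further on.
    have key : ∀ j y k w, μ j y = μ k w → g j y = g k w := by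
      intro j y k w h
      obtain ⟨l, hj, hk⟩ := exists_ge_ge j k
      obtain ⟨m, hm, h'⟩ := inj l (f hj y) (f hk w) (by rw [hcone, hcone, h])
      rw [← hgc hj, ← hgc hk, ← hgc hm, h', hgc hm]
    refine ⟨fun l => g (i l) (x l), fun j => funext fun y => key _ _ _ _ (hx _),
      fun ψ hψ => funext fun l => ?_⟩
    rw [← congrFun (hψ (i l)) (x l), Function.comp_apply, hx]

/-! ### Simplicial complexes and cylinders as unions of cells -/

namespace Arrangement

open Set

variable {F : Type*} [AddCommGroup F] [Module ℝ F]

/-- A simplex is an intersection of finitely many half-spaces. -/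
theorem exists_convexHull_eq_halfspaces [FiniteDimensional ℝ F] {s : Finset F}
    (hs : AffineIndependent ℝ ((↑) : s → F)) :
    ∃ 𝓛 : Set (F →ᵃ[ℝ] ℝ), 𝓛.Finite ∧ convexHull ℝ (s : Set F) = {x | ∀ ℓ ∈ 𝓛, 0 ≤ ℓ x} := by
  classical
  -- The vertices are completed to an affine basis. The simplex is where all barycentric coordinates
  -- are nonnegative and those of the added points are also nonpositive.
  obtain ⟨t, hst, ht, hspan⟩ := exists_subset_affineIndependent_affineSpan_eq_top
    (s := (s : Set F)) hs
  let b : AffineBasis t ℝ F := ⟨(↑), ht, by rw [Subtype.range_coe, hspan]⟩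
  have hb : ∀ j, b j = j := fun _ => rfl
  have : Finite t := finite_of_fin_dim_affineIndependent ℝ ht
  have := Fintype.ofFinite t
  refine ⟨range b.coord ∪ (fun j => -b.coord j) '' {j | (j : F) ∉ s},
    (finite_range _).union ((toFinite _).image _), Subset.antisymm ?_ fun x hx => ?_⟩
  · refine convexHull_min (fun x hx ℓ hℓ => ?_) ?_
    · have hcoord : ∀ j, b.coord j x = if j = ⟨x, hst hx⟩ then 1 else 0 := fun j =>
        b.coord_apply j ⟨x, hst hx⟩
      rcases hℓ with ⟨j, rfl⟩ | ⟨j, hj, rfl⟩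
      · rw [hcoord]
        split_ifs <;> norm_num
      · change 0 ≤ -(b.coord j x)
        rw [hcoord, if_neg, neg_zero]
        rintro rfl
        exact hj hx
    · have : {x | ∀ ℓ ∈ range b.coord ∪ (fun j => -b.coord j) '' {j | (j : F) ∉ s}, 0 ≤ ℓ x} =
          ⋂ ℓ ∈ range b.coord ∪ (fun j => -b.coord j) '' {j | (j : F) ∉ s},
            (ℓ : F →ᵃ[ℝ] ℝ) ⁻¹' Ici 0 := by
        ext x
        simp only [mem_iInter, mem_preimage, mem_Ici]
        rfl
      rw [this]
      exact convex_iInter₂ fun ℓ _ => (convex_Ici 0).affine_preimage ℓ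
  · have hpos : ∀ j, 0 ≤ b.coord j x := fun j => hx _ (Or.inl ⟨j, rfl⟩)
    have hzero : ∀ j : t, (j : F) ∉ s → b.coord j x = 0 := fun j hj =>
      le_antisymm (neg_nonneg.1 (hx _ (Or.inr ⟨j, hj, rfl⟩))) (hpos j)
    have hsum : ∑ j ∈ Finset.univ.filter (fun j : t => (j : F) ∈ s), b.coord j x = 1 := by
      rw [← b.sum_coord_apply_eq_one x]
      exact Finset.sum_filter_of_ne fun j _ hj => by_contra fun h => hj (hzero j h)
    rw [← b.linear_combination_coord_eq_self x,
      ← Finset.sum_filter_of_ne (p := fun j : t => (j : F) ∈ s) fun j _ hj => by_contra fun h =>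
        hj (by rw [hzero j h, zero_smul])]
    exact (convex_convexHull ℝ _).sum_mem (fun j _ => hpos j) hsum fun j hj =>
      subset_convexHull ℝ _ (Finset.mem_filter.1 hj).2

/-- The simplices of a finite simplicial complex are unions of cells of an arrangement. -/
theorem exists_saturated_faces [FiniteDimensional ℝ F] (S : Geometry.SimplicialComplex ℝ F)
    (hS : S.faces.Finite) :
    ∃ 𝓛 : Set (F →ᵃ[ℝ] ℝ), 𝓛.Finite ∧ ∀ s ∈ S.faces, Saturated 𝓛 (convexHull ℝ (s : Set F)) := by
  choose! 𝓛 h𝓛 hs using fun s (hs : s ∈ S.faces) => exists_convexHull_eq_halfspaces (S.indep hs)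
  refine ⟨⋃ s ∈ S.faces, 𝓛 s, hS.biUnion h𝓛, fun s h => ?_⟩
  rw [hs s h]
  exact fun x hx y hy ℓ hℓ => (hy ℓ (mem_biUnion h hℓ)).1 (hx ℓ hℓ)

/-- An arrangement in `F × ℝ` with cells adapted to `F × [0,1]`. -/
def cylinder (𝓛 : Set (F →ᵃ[ℝ] ℝ)) : Set (F × ℝ →ᵃ[ℝ] ℝ) :=
  (fun ℓ => ℓ.comp (LinearMap.fst ℝ F ℝ).toAffineMap) '' 𝓛 ∪
    {(LinearMap.snd ℝ F ℝ).toAffineMap,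
      AffineMap.const ℝ (F × ℝ) (1 : ℝ) - (LinearMap.snd ℝ F ℝ).toAffineMap}

variable {𝓛 : Set (F →ᵃ[ℝ] ℝ)}

theorem finite_cylinder (h : 𝓛.Finite) : (cylinder 𝓛).Finite :=
  (h.image _).union (toFinite _)

theorem cell_cylinder {p q : F × ℝ} (h : q ∈ cell (cylinder 𝓛) p) :
    q.1 ∈ cell 𝓛 p.1 ∧ ((0 ≤ p.2 → 0 ≤ q.2) ∧ (p.2 ≤ 0 → q.2 ≤ 0)) ∧
      ((p.2 ≤ 1 → q.2 ≤ 1) ∧ (1 ≤ p.2 → 1 ≤ q.2)) := by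
  refine ⟨fun ℓ hℓ => h _ (Or.inl ⟨ℓ, hℓ, rfl⟩), h _ (Or.inr (Or.inl rfl)), ?_⟩
  simpa using h _ (Or.inr (Or.inr rfl))

theorem saturated_cylinder_Icc {Y : Set F} (hY : Saturated 𝓛 Y) :
    Saturated (cylinder 𝓛) (Y ×ˢ Icc (0 : ℝ) 1) := fun p hp q hq => by
  obtain ⟨h1, h2, h3⟩ := cell_cylinder hq
  exact ⟨hY _ hp.1 h1, h2.1 hp.2.1, h3.1 hp.2.2⟩

theorem saturated_cylinder_zero {Y : Set F} (hY : Saturated 𝓛 Y) :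
    Saturated (cylinder 𝓛) (Y ×ˢ {(0 : ℝ)}) := fun p hp q hq => by
  obtain ⟨h1, h2, h3⟩ := cell_cylinder hq
  exact ⟨hY _ hp.1 h1, le_antisymm (h2.2 (le_of_eq hp.2)) (h2.1 (ge_of_eq hp.2))⟩

theorem saturated_cylinder_one {Y : Set F} (hY : Saturated 𝓛 Y) :
    Saturated (cylinder 𝓛) (Y ×ˢ {(1 : ℝ)}) := fun p hp q hq => by
  obtain ⟨h1, h2, h3⟩ := cell_cylinder hq
  exact ⟨hY _ hp.1 h1, le_antisymm (h3.1 (le_of_eq hp.2)) (h3.2 (ge_of_eq hp.2))⟩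

end Arrangement

/-! ### Surjectivity and injectivity on homotopy classes -/

namespace DirectedFamily

open scoped unitInterval Topology
open Set Arrangement

variable {A : Type u₁} [Preorder A] [IsDirectedOrder A] {M : Type u₂} [TopologicalSpace M]
  {D : DirectedFamily A M} {F : Type u₅} [AddCommGroup F] [Module ℝ F] [FiniteDimensional ℝ F]
  [TopologicalSpace F] [IsTopologicalAddGroup F] [ContinuousSMul ℝ F] [T2Space F]
  {𝓛 : Set (F →ᵃ[ℝ] ℝ)} {C X : Set F}

/-- A continuous map on a polyhedron which is constant on a subpolyhedron is relatively homotopic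
to a continuous map into some `M_β`. -/
theorem exists_homotopicRel (hdense : Dense D.union)
    (hM : AdmitsWellFilledCharts.{u₁, u₂, u₃, u₄} D) (h𝓛 : 𝓛.Finite) (hC : Saturated 𝓛 C)
    (hX : Saturated 𝓛 X) (hCX : C ⊆ X) (hXc : IsCompact X) {p : M} (hp : p ∈ D.union)
    (γ : C(X, M)) (hγ : ∀ x : X, (x : F) ∈ C → γ x = p) :
    ∃ (β : A) (hβ : p ∈ D.carrier β) (η : C(X, D.Step β)), (∀ x : X, (x : F) ∈ C → η x = D.pt hβ) ∧
      ContinuousMap.HomotopicRel ((D.incl β).comp η) γ ((↑) ⁻¹' C : Set X) := by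
  classical
  obtain ⟨α, hα⟩ := mem_iUnion.1 hp
  let f : F → M := fun x => if h : x ∈ X then γ ⟨x, h⟩ else p
  have hfX : ∀ x : X, f x = γ x := fun x => dif_pos x.2
  have hf : ContinuousOn f X :=
    continuousOn_iff_continuous_domRestrict.2 (γ.continuous.congr fun x => (hfX x).symm)
  obtain ⟨β, hαβ, H, hHc, hH0, hHC, -, g, hg⟩ := exists_compression hdense hM
    (Module.finrank ℝ F + 1) h𝓛 hC hX hCX hXc
    (fun x _ _ => Nat.lt_succ_of_le (Submodule.finrank_le _)) hf
    (LiftsOn.const (s := C) hα fun x hx => (hfX ⟨x, hCX hx⟩).trans (hγ _ hx)) isOpen_univ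
    fun _ _ => mem_univ _
  refine ⟨β, D.mono hαβ hα, g, fun x hx => Subtype.ext ((hg x).trans
    ((hHC x hx 1).trans ((hfX x).trans (hγ x hx)))), ContinuousMap.HomotopicRel.symm ⟨⟨⟨⟨fun z => H (z.2, z.1), ?_⟩, ?_, ?_⟩, ?_⟩⟩⟩
  · exact hHc.comp_continuous (by fun_prop) fun z => ⟨z.2.2, mem_univ _⟩
  · exact fun x => (hH0 x x.2).trans (hfX x)
  · exact fun x => (hg x).symm
  · exact fun t x hx => (hHC x hx t).trans (hfX x)

/-- Maps into `M_α` on a polyhedron that are relatively homotopic in `M` are relatively homotopic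
in some `M_β`. -/
theorem exists_homotopicRel_trans (hdense : Dense D.union)
    (hM : AdmitsWellFilledCharts.{u₁, u₂, u₃, u₄} D) (h𝓛 : 𝓛.Finite) (hC : Saturated 𝓛 C)
    (hX : Saturated 𝓛 X) (hCX : C ⊆ X) (hXc : IsCompact X) {α : A} {p : D.Step α}
    {γ η : C(X, D.Step α)} (hγ : ∀ x : X, (x : F) ∈ C → γ x = p)
    (h : ContinuousMap.HomotopicRel ((D.incl α).comp γ) ((D.incl α).comp η)
      ((↑) ⁻¹' C : Set X)) :
    ∃ (β : A) (hαβ : α ≤ β), ContinuousMap.HomotopicRel ((D.trans hαβ).comp γ)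
      ((D.trans hαβ).comp η) ((↑) ⁻¹' C : Set X) := by
  classical
  obtain ⟨h⟩ := h
  let f : F × ℝ → M := fun z =>
    if hz : z.1 ∈ X then h (projIcc 0 1 zero_le_one z.2, ⟨z.1, hz⟩) else p.1
  have hfX : ∀ z (hz : z.1 ∈ X), f z = h (projIcc 0 1 zero_le_one z.2, ⟨z.1, hz⟩) := fun z hz =>
    dif_pos hz
  have hf : ContinuousOn f (X ×ˢ Icc 0 1) := by
    rw [continuousOn_iff_continuous_domRestrict]
    have : Continuous fun z : ↥(X ×ˢ Icc (0 : ℝ) 1) =>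
        h (projIcc 0 1 zero_le_one z.1.2, ⟨z.1.1, z.2.1⟩) := by fun_prop
    exact this.congr fun z => (hfX z.1 z.2.1).symm
  have h0 : ∀ x : X, f (x, 0) = D.incl α (γ x) := fun x => by
    simp [hfX (x, 0) x.2]
  have h1 : ∀ x : X, f (x, 1) = D.incl α (η x) := fun x => by
    simp [hfX (x, 1) x.2]
  have hfC : ∀ x (hx : x ∈ C) (t : ℝ), f (x, t) = D.incl α (γ ⟨x, hCX hx⟩) := fun x hx t =>
    (hfX (x, t) (hCX hx)).trans (h.prop _ ⟨x, hCX hx⟩ hx)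
  have hXcl := hXc.isClosed
  have hCcl := hC.isClosed h𝓛
  have hsat := ((saturated_cylinder_zero hX).union (saturated_cylinder_one hX)).union
    (saturated_cylinder_Icc hC)
  have hlift : D.LiftsOn α (X ×ˢ {(0 : ℝ)} ∪ X ×ˢ {(1 : ℝ)} ∪ C ×ˢ Icc (0 : ℝ) 1) f := by
    refine .union ((hXcl.prod isClosed_singleton).union (hXcl.prod isClosed_singleton))
      (hCcl.prod isClosed_Icc) (.union (hXcl.prod isClosed_singleton)
      (hXcl.prod isClosed_singleton) ?_ ?_) ?_
    · refine ⟨γ.comp ⟨fun z => ⟨z.1.1, z.2.1⟩, by fun_prop⟩, ?_⟩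
      exact fun z => (h0 ⟨z.1.1, z.2.1⟩).symm.trans (congrArg f (Prod.ext rfl z.2.2.symm))
    · refine ⟨η.comp ⟨fun z => ⟨z.1.1, z.2.1⟩, by fun_prop⟩, ?_⟩
      exact fun z => (h1 ⟨z.1.1, z.2.1⟩).symm.trans (congrArg f (Prod.ext rfl z.2.2.symm))
    · refine .const p.2 fun z hz => ?_
      rw [← Prod.mk.eta (p := z), hfC _ hz.1, hγ ⟨z.1, hCX hz.1⟩ hz.1]
      rfl
  have hsub : X ×ˢ {(0 : ℝ)} ∪ X ×ˢ {(1 : ℝ)} ∪ C ×ˢ Icc (0 : ℝ) 1 ⊆ X ×ˢ Icc (0 : ℝ) 1 :=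
    union_subset (union_subset (prod_mono Subset.rfl (by simp))
      (prod_mono Subset.rfl (by simp))) (prod_mono hCX Subset.rfl)
  -- Only the end of the deformation matters: it is a homotopy in `M_β`, and on both ends of the
  -- cylinder and over `C` it is unchanged.
  obtain ⟨β, hαβ, H, -, -, hHr, -, g, hg⟩ := exists_compression hdense hM
    (Module.finrank ℝ (F × ℝ) + 1) (finite_cylinder h𝓛) hsat (saturated_cylinder_Icc hX) hsub
    (hXc.prod isCompact_Icc)
    (fun x _ _ => Nat.lt_succ_of_le (Submodule.finrank_le _)) hf hlift isOpen_univ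
    fun _ _ => mem_univ _
  refine ⟨β, hαβ, ⟨⟨⟨⟨fun z => g ⟨(z.2, z.1), z.2.2, z.1.2⟩, by fun_prop⟩, ?_, ?_⟩, ?_⟩⟩⟩
  · exact fun x => Subtype.ext ((hg _).trans
      ((hHr (x, 0) (Or.inl (Or.inl ⟨x.2, rfl⟩)) 1).trans (h0 x)))
  · exact fun x => Subtype.ext ((hg _).trans
      ((hHr (x, 1) (Or.inl (Or.inr ⟨x.2, rfl⟩)) 1).trans (h1 x)))
  · exact fun t x hx => Subtype.ext ((hg _).trans
      ((hHr (x, t) (Or.inr ⟨hx, t.2⟩) 1).trans (hfC x hx t)))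

end DirectedFamily

open DirectedFamily in
theorem mainTheorem1
    {F : Type u₅} [AddCommGroup F] [Module ℝ F] [FiniteDimensional ℝ F]
    [TopologicalSpace F] [IsTopologicalAddGroup F] [ContinuousSMul ℝ F] [T2Space F]
    (S : Geometry.SimplicialComplex ℝ F) (hS : S.faces.Finite)
    (C : Set F)
    (hC : C = ⋃ s ∈ {s ∈ S.faces | convexHull ℝ (s : Set F) ⊆ C}, convexHull ℝ (s : Set F))
    {A : Type u₁} [Preorder A] [IsDirectedOrder A]
    {M : Type u₂} [TopologicalSpace M] [T2Space M]
    (D : DirectedFamily A M)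
    (hdense : Dense D.union)
    (hM : DirectedFamily.AdmitsWellFilledCharts.{u₁, u₂, u₃, u₄} D)
    (p : M) (hp : p ∈ D.union) :
    IsSetDirectLimit.{_, _, _, z} (D.transClasses ((↑) ⁻¹' C : Set S.space) p)
      (D.inclClasses ((↑) ⁻¹' C : Set S.space) p) := by
  obtain ⟨𝓛, h𝓛, hsat⟩ := Arrangement.exists_saturated_faces S hS
  have hX : Arrangement.Saturated 𝓛 S.space := fun x hx => by
    obtain ⟨s, hs, hxs⟩ := S.mem_space_iff.1 hx
    exact (hsat s hs x hxs).trans (S.convexHull_subset_space hs)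
  have hCS : Arrangement.Saturated 𝓛 C := fun x hx => by
    rw [hC] at hx
    obtain ⟨s, hs, hxs⟩ := Set.mem_iUnion₂.1 hx
    exact (hsat s hs.1 x hxs).trans hs.2
  have hCX : C ⊆ S.space := fun x hx => by
    rw [hC] at hx
    obtain ⟨s, hs, hxs⟩ := Set.mem_iUnion₂.1 hx
    exact S.convexHull_subset_space hs.1 hxs
  have hXc : IsCompact S.space :=
    hS.isCompact_biUnion fun s _ => s.finite_toSet.isCompact_convexHull ℝ
  refine .of_surjective_of_injective (fun α β h => ?_) (fun ξ => ?_) fun α ξ ζ h => ?_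
  · funext ξ
    induction ξ using Quotient.inductionOn'
    rfl
  · induction ξ using Quotient.inductionOn' with | _ γ
    obtain ⟨β, hβ, η, hη, h⟩ := exists_homotopicRel hdense hM h𝓛 hCS hX hCX hXc hp γ.1 γ.2
    exact ⟨⟨β, hβ⟩, Quotient.mk'' ⟨η, hη⟩, Quotient.sound h⟩
  · induction ξ using Quotient.inductionOn' with | _ γ
    induction ζ using Quotient.inductionOn' with | _ η
    obtain ⟨β, hαβ, hβ⟩ := exists_homotopicRel_trans hdense hM h𝓛 hCS hX hCX hXc γ.2
      (Quotient.exact h)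
    exact ⟨⟨β, D.mono hαβ α.2⟩, hαβ, Quotient.sound hβ⟩
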